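/- Let $\eta_1=0.1866823\ldots$ be the smaller of the two positive real solutions of $\eta(1-\log\eta)=1/2$, and let $0<\delta_1<\eta_1$. For an integer $n\ge 1$ let $r=r(n)$ be the real solution of $re^{r}=n$. For a set $\mathcal S$ of positive integers let $B_{n,\mathcal S}$ be the number of partitions of a set with $n$ elements into nonempty blocks, none of whose sizes lies in $\mathcal S$, and let $\alpha(z)=\alpha_{\mathcal S}(z)=\sum_{k\in\mathcal S} z^k/k!$. Then $$B_{n,\mathcal S}=\frac{n!\,\exp\bigl(e^{r}-1-\alpha(r)\bigr)}{r^{n}\sqrt{2\pi r(r+1)e^{r}}}\left(1+O\left(\frac{(er/m)^{2m-2}}{e^{r}}\right)\right),\qquad m=\max\mathcal S,$$ uniformly for all $n\ge1$ and all nonempty finite sets $\mathcal S$ of positive integers with $1\le m\le\delta_1 r$; the constant implied by the $O$ depends only on $\delta_1$. -/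

import Mathlib

/-- `partitionCount n S` is the number of set partitions of an `n`-element set, into nonempty
blocks, none of whose block sizes belongs to `S`. -/
noncomputable def partitionCount (n : ℕ) (S : Set ℕ) : ℕ :=
  Nat.card {P : Finpartition (Finset.univ : Finset (Fin n)) // ∀ b ∈ P.parts, b.card ∉ S}

/-- The function `α_S(x) = ∑_{k ∈ S} x ^ k / k!`. -/
noncomputable def alphaFun (S : Set ℕ) (x : ℝ) : ℝ :=
  ∑' k : S, x ^ (k : ℕ) / (Nat.factorial (k : ℕ) : ℝ)

/-- The main term `n! exp(e ^ r - 1 - α_S(r)) / (r ^ n √(2 π r (r + 1) e ^ r))`. -/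
noncomputable def mainTerm (n : ℕ) (S : Set ℕ) (r : ℝ) : ℝ :=
  (Nat.factorial n : ℝ) * Real.exp (Real.exp r - 1 - alphaFun S r) /
    (r ^ n * Real.sqrt (2 * Real.pi * r * (r + 1) * Real.exp r))

/-! The proof is a saddle point estimate. The exponential formula and Cauchy's formula on the circle
of radius `r` write the count divided by the main term as `√(A / (2π))` times the integral of `exp
(phase)`, with `A = r (r + 1) e ^ r` (`partitionCount_div_mainTerm`). The radius is the saddle point
for `e ^ z` alone, so the excluded sizes leave an uncancelled linear term in the phase, of slope at
most `3 r Q` with `Q = (e r / m) ^ (m - 1)` (`weightMoment_one_le`). On the Gaussian scale `A ^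
(-1/2)` this term has size `Q e ^ (-r / 2)`, but it is odd in `θ`. Averaging over `θ` and `-θ`
removes it, together with the cubic term of `e ^ z`, and only second-order effects remain, of size
`Q ^ 2 / e ^ r`: the asserted error (`norm_symm_cexp_phase_sub_le`).

The condition on `δ₁` says precisely that `Q ≤ e ^ (r / 2)` (`pow_le_exp_half`). For large `r` the
excluded sizes then spoil neither the quadratic decay for `|θ| ≤ 1 / r` nor the smallness of the
integrand elsewhere (`re_phase_le_of_abs_le`, `re_phase_le_of_le_abs`). For bounded `r` only
finitely many `n` occur, and crude bounds suffice. -/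

/-! ### The exponential formula for restricted block sizes -/

open Finset in
/-- Conditioning on the block containing a distinguished element. -/
theorem card_finpartition_insert {α : Type*} [DecidableEq α] (p : ℕ → Prop) [DecidablePred p]
    {a : α} {s : Finset α} (ha : a ∉ s) :
    #{P : Finpartition (insert a s) | ∀ b ∈ P.parts, p #b} =
      ∑ t ∈ s.powerset,
        if p (#t + 1) then #{P : Finpartition (s \ t) | ∀ b ∈ P.parts, p #b} else 0 := by
  classical
  rw [card_eq_sum_card_fiberwise (f := fun P => (P.part a).erase a) (t := s.powerset)]
  · refine sum_congr rfl fun t ht => ?_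
    rw [mem_powerset] at ht
    have hat : a ∉ t := fun h => ha (ht h)
    have hsd : insert a s \ insert a t = s \ t := by
      ext x; simp only [mem_sdiff, mem_insert]; grind
    have hpart : ∀ P : Finpartition (insert a s), (P.part a).erase a = t →
        insert a t ∈ P.parts := by
      intro P hP
      have h1 : a ∈ P.part a := P.mem_part (mem_insert_self a s)
      rw [← hP, insert_erase h1]
      exact P.part_mem.2 (mem_insert_self a s)
    split_ifs with hp
    · have hdisj : Disjoint (s \ t) (insert a t) := by
        rw [disjoint_left]; intro x; simp only [mem_sdiff, mem_insert]; grind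
      have hsup : (s \ t) ⊔ insert a t = insert a s := by
        ext x; simp only [sup_eq_union, mem_union, mem_sdiff, mem_insert]; grind
      have havoid : ∀ P : Finpartition (insert a s), insert a t ∈ P.parts →
          (P.avoid (insert a t)).parts = P.parts.erase (insert a t) := by
        intro P hP
        ext c
        rw [Finpartition.mem_avoid, mem_erase]
        constructor
        · rintro ⟨d, hd, hdt, rfl⟩
          have hne : d ≠ insert a t := fun h => hdt h.le
          have hdj : Disjoint d (insert a t) := P.disjoint hd hP hne
          rw [sdiff_eq_self_of_disjoint hdj]
          exact ⟨hne, hd⟩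
        · rintro ⟨hne, hc⟩
          have hdj : Disjoint c (insert a t) := P.disjoint hc hP hne
          refine ⟨c, hc, fun h => ?_, sdiff_eq_self_of_disjoint hdj⟩
          exact P.ne_bot hc (disjoint_self.1 (hdj.mono_right h))
      -- Deleting the block `insert a t` and adjoining it again are mutually inverse.
      refine card_bij' (fun P _ => (P.avoid (insert a t)).copy hsd)
        (fun Q _ => Q.extend (b := insert a t) (by simp) hdisj hsup) ?_ ?_ ?_ ?_
      · intro P hP
        simp only [mem_filter, mem_univ, true_and] at hP ⊢
        intro b hb
        change b ∈ (P.avoid (insert a t)).parts at hb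
        rw [havoid P (hpart P hP.2)] at hb
        exact hP.1 b (mem_of_mem_erase hb)
      · intro Q hQ
        simp only [mem_filter, mem_univ, true_and] at hQ ⊢
        refine ⟨?_, ?_⟩
        · intro b hb
          rw [Finpartition.extend_parts, mem_insert] at hb
          rcases hb with rfl | hb
          · rwa [card_insert_of_notMem hat]
          · exact hQ b hb
        · rw [Finpartition.part_eq_of_mem (t := insert a t), erase_insert hat]
          · simp
          · simp
      · intro P hP
        simp only [mem_filter, mem_univ, true_and] at hP
        ext b
        rw [Finpartition.extend_parts]
        change b ∈ insert (insert a t) (P.avoid (insert a t)).parts ↔ _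
        rw [havoid P (hpart P hP.2), insert_erase (hpart P hP.2)]
      · intro Q hQ
        ext b
        change b ∈ (Finpartition.avoid _ (insert a t)).parts ↔ _
        rw [havoid _ (by simp), Finpartition.extend_parts, erase_insert]
        intro h
        exact (mem_sdiff.1 (Q.le h (mem_insert_self a t))).1 |> ha
    · rw [card_eq_zero, filter_eq_empty_iff]
      intro P hP hPt
      simp only [mem_filter, mem_univ, true_and] at hP
      apply hp
      rw [← card_insert_of_notMem hat]
      exact hP _ (hpart P hPt)
  · intro P hP
    simp only [coe_powerset, Set.mem_preimage, Set.mem_powerset_iff, coe_subset]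
    intro x hx
    have := P.part_subset a (mem_of_mem_erase hx)
    exact (mem_insert.1 this).resolve_left (ne_of_mem_erase hx)

open Finset in
/-- The exponential formula: the number of partitions of `s` with all block sizes satisfying `p`
is the `#s`-th derivative at `0` of `exp ∘ F`, where `F` generates the admissible block sizes. -/
theorem card_finpartition_eq_iteratedDeriv {α : Type*} [DecidableEq α] (p : ℕ → Prop)
    [DecidablePred p] {F : ℂ → ℂ} (hF : ContDiff ℂ (⊤ : ℕ∞) F) (hF0 : F 0 = 0)
    (hFd : ∀ k, iteratedDeriv (k + 1) F 0 = if p (k + 1) then 1 else 0) (s : Finset α) :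
    (#{P : Finpartition s | ∀ b ∈ P.parts, p #b} : ℂ) =
      iteratedDeriv #s (fun z => Complex.exp (F z)) 0 := by
  induction hn : #s using Nat.strong_induction_on generalizing s with
  | _ n ih =>
    rcases s.eq_empty_or_nonempty with rfl | ⟨a, ha⟩
    · have hu : ({P : Finpartition (∅ : Finset α) | ∀ b ∈ P.parts, p #b} : Finset _) =
          {(Inhabited.default : Finpartition (⊥ : Finset α))} := by
        ext P
        have : P = (Inhabited.default : Finpartition (⊥ : Finset α)) :=
          Subsingleton.elim (α := Finpartition (⊥ : Finset α)) _ _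
        subst this
        have h0 : (Inhabited.default : Finpartition (⊥ : Finset α)).parts = ∅ := rfl
        simp [h0]
      rw [card_empty] at hn
      subst hn
      rw [hu]
      simp [hF0]
    · obtain ⟨u, hu, rfl⟩ : ∃ u, a ∉ u ∧ insert a u = s := ⟨s.erase a, by simp, insert_erase ha⟩
      rw [card_insert_of_notMem hu] at hn
      subst hn
      have hd : deriv (fun z => Complex.exp (F z)) =
          deriv F * fun z => Complex.exp (F z) := by
        ext z
        rw [deriv_cexp (hF.differentiable (by simp) z)]
        simp [mul_comm]
      -- Leibniz's rule for `(exp F)' = F' exp F` is the combinatorial recursion with the subsets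
      -- `t` grouped by cardinality.
      rw [iteratedDeriv_succ', hd, iteratedDeriv_mul, card_finpartition_insert p hu]
      · simp only [← iteratedDeriv_succ', hFd]
        have key : ∀ t ∈ u.powerset,
            ((if p (#t + 1) then #{P : Finpartition (u \ t) | ∀ b ∈ P.parts, p #b} else 0 : ℕ) : ℂ)
            = (if p (#t + 1) then (1 : ℂ) else 0) *
              iteratedDeriv (#u - #t) (fun z => Complex.exp (F z)) 0 := by
          intro t ht
          rw [mem_powerset] at ht
          have hc := card_sdiff_of_subset ht
          split_ifs
          · rw [ih _ (by omega) (u \ t) hc, one_mul]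
          · simp
        rw [Nat.cast_sum, sum_congr rfl key, sum_powerset_apply_card
          (f := fun j => (if p (j + 1) then (1 : ℂ) else 0) *
              iteratedDeriv (#u - j) (fun z => Complex.exp (F z)) 0)]
        refine sum_congr rfl fun k _ => ?_
        simp [nsmul_eq_mul]
      · have : ContDiff ℂ (⊤ : ℕ∞) (deriv F) := by
          have := hF.iterate_deriv 1
          simpa using this
        exact (this.of_le (by exact_mod_cast le_top)).contDiffAt
      · exact ((Complex.contDiff_exp.comp hF).of_le (by exact_mod_cast le_top)).contDiffAt

/-- The exponential generating function of the block sizes outside `T`. -/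
noncomputable def blockEGF (T : Finset ℕ) (z : ℂ) : ℂ :=
  Complex.exp z - 1 - ∑ k ∈ T, z ^ k / (k.factorial : ℂ)

theorem contDiff_blockEGF (T : Finset ℕ) : ContDiff ℂ (⊤ : ℕ∞) (blockEGF T) := by
  unfold blockEGF
  refine (Complex.contDiff_exp.sub contDiff_const).sub (ContDiff.sum fun k _ => ?_)
  exact (contDiff_id.pow k).div_const _

theorem blockEGF_zero {T : Finset ℕ} (hT : 0 ∉ T) : blockEGF T 0 = 0 := by
  unfold blockEGF
  rw [Finset.sum_eq_zero]
  · simp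
  · intro k hk
    have : k ≠ 0 := fun h => hT (h ▸ hk)
    simp [this]

theorem iteratedDeriv_blockEGF (T : Finset ℕ) (k : ℕ) :
    iteratedDeriv (k + 1) (blockEGF T) 0 = if k + 1 ∉ T then 1 else 0 := by
  unfold blockEGF
  have hs : ∀ j ∈ T, ContDiffAt ℂ (k + 1 : ℕ) (fun z : ℂ => z ^ j / (j.factorial : ℂ)) 0 :=
    fun j _ => ((contDiff_id.pow j).div_const _).contDiffAt
  rw [iteratedDeriv_fun_sub (Complex.contDiff_exp.sub contDiff_const).contDiffAt
    (ContDiffAt.sum hs), iteratedDeriv_fun_sub Complex.contDiff_exp.contDiffAt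
    contDiff_const.contDiffAt, iteratedDeriv_fun_sum hs]
  have h1 : ∀ j ∈ T, iteratedDeriv (k + 1) (fun z : ℂ => z ^ j / (j.factorial : ℂ)) 0 =
      if k + 1 = j then 1 else 0 := by
    intro j _
    simp only [div_eq_inv_mul]
    rw [iteratedDeriv_const_mul_field, iteratedDeriv_fun_pow_zero]
    split_ifs
    · exact inv_mul_cancel₀ (by exact_mod_cast j.factorial_ne_zero)
    · simp
  rw [Finset.sum_congr rfl h1, Finset.sum_ite_eq, iteratedDeriv_eq_iterate, Complex.iter_deriv_exp]
  simp [iteratedDeriv_const]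
  split_ifs <;> simp

theorem partitionCount_eq_iteratedDeriv (n : ℕ) {T : Finset ℕ} (hT : 0 ∉ T) :
    (partitionCount n (T : Set ℕ) : ℂ) =
      iteratedDeriv n (fun z => Complex.exp (blockEGF T z)) 0 := by
  classical
  have := card_finpartition_eq_iteratedDeriv (fun k => k ∉ T) (contDiff_blockEGF T)
    (blockEGF_zero hT) (iteratedDeriv_blockEGF T) (Finset.univ : Finset (Fin n))
  rw [Finset.card_univ, Fintype.card_fin] at this
  rw [← this, partitionCount, Nat.card_eq_fintype_card, Fintype.card_subtype]
  congr!

/-! ### Cauchy's formula -/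

open Complex in
/-- Cauchy's formula on the circle of radius `r`. -/
theorem partitionCount_eq_integral (n : ℕ) {T : Finset ℕ} (hT : 0 ∉ T) {r : ℝ} (hr : 0 < r) :
    (partitionCount n (T : Set ℕ) : ℂ) * r ^ n / n.factorial =
      (2 * Real.pi : ℂ)⁻¹ * ∫ θ in (-Real.pi)..Real.pi,
        exp (blockEGF T (r * exp (θ * I)) - n * θ * I) := by
  set f : ℂ → ℂ := fun z => exp (blockEGF T z) with hf
  have hfd : Differentiable ℂ f :=
    (Complex.contDiff_exp.comp (contDiff_blockEGF T)).differentiable (by simp)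
  have h1 := DiffContOnCl.circleIntegral_one_div_sub_center_pow_smul hr n
    (hfd.diffContOnCl (s := Metric.ball 0 r))
  rw [partitionCount_eq_iteratedDeriv n hT]
  set D := iteratedDeriv n f 0
  -- As `n` is an integer the integrand has period `2π`; the interval can be centred at `0`, as the
  -- later symmetrisation requires.
  have hper : Function.Periodic
      (fun θ : ℝ => exp (blockEGF T (r * exp (θ * I)) - n * θ * I)) (2 * Real.pi) := by
    intro θ
    have e1 : exp (((θ + 2 * Real.pi : ℝ) : ℂ) * I) = exp (θ * I) := by
      push_cast
      rw [add_mul, Complex.exp_periodic]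
    simp only [e1]
    rw [Complex.exp_eq_exp_iff_exists_int]
    exact ⟨-n, by push_cast; ring⟩
  have h2 := hper.intervalIntegral_add_eq 0 (-Real.pi)
  have e3 : -Real.pi + 2 * Real.pi = Real.pi := by ring
  rw [zero_add, e3] at h2
  rw [← h2]
  rw [circleIntegral] at h1
  have h3 : ∀ θ : ℝ, deriv (circleMap 0 r) θ • (1 / (circleMap 0 r θ - 0) ^ (n + 1)) •
      f (circleMap 0 r θ) = (I * ((r : ℂ) ^ n)⁻¹) *
        exp (blockEGF T (r * exp (θ * I)) - n * θ * I) := by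
    intro θ
    rw [deriv_circleMap, Complex.exp_sub]
    simp only [circleMap, zero_add, sub_zero, smul_eq_mul, hf]
    have hr' : (r : ℂ) ≠ 0 := by exact_mod_cast hr.ne'
    have : exp (n * θ * I) = exp (θ * I) ^ n := by
      rw [← Complex.exp_nat_mul]; congr 1; ring
    rw [this]
    have := Complex.exp_ne_zero (θ * I)
    field_simp
    ring
  simp only [h3, intervalIntegral.integral_const_mul] at h1
  set J := ∫ θ in (0 : ℝ)..2 * Real.pi, exp (blockEGF T (r * exp (θ * I)) - n * θ * I)
  have hr' : (r : ℂ) ^ n ≠ 0 := pow_ne_zero _ (by exact_mod_cast hr.ne')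
  have hn : (n.factorial : ℂ) ≠ 0 := by exact_mod_cast n.factorial_ne_zero
  have hpi : (Real.pi : ℂ) ≠ 0 := by exact_mod_cast Real.pi_ne_zero
  rw [smul_eq_mul] at h1
  field_simp at h1 ⊢
  rw [mul_comm] at h1
  linear_combination -h1

/-! ### Taylor remainders of the exponential -/

/-- Taylor's formula for `exp`, with a bound that does not see the imaginary part. -/
theorem norm_cexp_sub_sum_le (n : ℕ) (w : ℂ) :
    ‖Complex.exp w - ∑ j ∈ Finset.range n, w ^ j / (j.factorial : ℂ)‖ ≤
      ‖w‖ ^ n * max 1 (Real.exp w.re) := by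
  induction n generalizing w with
  | zero => simp [Complex.norm_exp]
  | succ n ih =>
    -- Each remainder is the derivative of the next, so the mean value inequality along the segment
    -- from `0` to `w` drives the induction.
    set S : ℕ → ℂ → ℂ := fun n z =>
      Complex.exp z - ∑ j ∈ Finset.range n, z ^ j / (j.factorial : ℂ) with hS
    have hd : ∀ z, HasDerivAt (S (n + 1)) (S n z) z := by
      intro z
      simp only [hS]
      refine (Complex.hasDerivAt_exp z).sub ?_
      simp only [Finset.sum_range_succ' _ n]
      rw [← add_zero (∑ j ∈ Finset.range n, z ^ j / (j.factorial : ℂ))]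
      refine HasDerivAt.add (HasDerivAt.fun_sum fun j _ => ?_) (by simpa using hasDerivAt_const z _)
      convert! (hasDerivAt_pow (j + 1) z).div_const ((j + 1).factorial : ℂ) using 1
      have : (j.factorial : ℂ) ≠ 0 := by exact_mod_cast j.factorial_ne_zero
      have : ((j : ℂ) + 1) ≠ 0 := by exact_mod_cast j.succ_ne_zero
      rw [Nat.factorial_succ]
      push_cast
      field_simp
    have hg : ∀ t ∈ Set.Icc (0 : ℝ) 1, HasDerivWithinAt (fun t : ℝ => S (n + 1) (t * w))
        (S n (t * w) * w) (Set.Icc 0 1) t := by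
      intro t _
      have h1 : HasDerivAt (fun t : ℝ => (t : ℂ) * w) w t := by
        simpa using (Complex.ofRealCLM.hasDerivAt (x := t)).mul_const w
      exact ((hd _).comp t h1).hasDerivWithinAt
    have hb : ∀ t ∈ Set.Ico (0 : ℝ) 1,
        ‖S n (t * w) * w‖ ≤ ‖w‖ ^ (n + 1) * max 1 (Real.exp w.re) := by
      intro t ht
      have hn : ‖(t : ℂ) * w‖ ≤ ‖w‖ := by
        rw [norm_mul, Complex.norm_real, Real.norm_of_nonneg ht.1]
        exact mul_le_of_le_one_left (norm_nonneg _) ht.2.le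
      have hm : max 1 (Real.exp ((t : ℂ) * w).re) ≤ max 1 (Real.exp w.re) := by
        rw [Complex.re_ofReal_mul]
        rcases le_total w.re 0 with h | h
        · refine max_le (le_max_left _ _) (le_max_of_le_left ?_)
          exact Real.exp_le_one_iff.2 (mul_nonpos_of_nonneg_of_nonpos ht.1 h)
        · refine max_le_max le_rfl (Real.exp_le_exp.2 ?_)
          exact mul_le_of_le_one_left h ht.2.le
      rw [norm_mul, pow_succ, mul_right_comm]
      gcongr
      exact (ih _).trans (by gcongr)
    have := norm_image_sub_le_of_norm_deriv_le_segment_01' hg hb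
    simpa [hS, Finset.sum_range_succ'] using this

open Complex in
theorem norm_cexp_mul_I_sub_sum_le (n : ℕ) (x : ℝ) :
    ‖exp (x * I) - ∑ j ∈ Finset.range n, (x * I) ^ j / (j.factorial : ℂ)‖ ≤ |x| ^ n := by
  simpa using norm_cexp_sub_sum_le n (x * I)

open Complex in
theorem norm_cexp_mul_I_sub_one_le (x : ℝ) : ‖exp (x * I) - 1‖ ≤ |x| := by
  simpa [Finset.sum_range_succ] using norm_cexp_mul_I_sub_sum_le 1 x

open Complex in
theorem norm_cexp_mul_I_sub_linear_le (x : ℝ) : ‖exp (x * I) - 1 - x * I‖ ≤ x ^ 2 := by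
  simpa [Finset.sum_range_succ, sub_sub] using norm_cexp_mul_I_sub_sum_le 2 x

open Complex in
theorem norm_cexp_mul_I_sub_quadratic_le (x : ℝ) :
    ‖exp (x * I) - 1 - x * I + x ^ 2 / 2‖ ≤ |x| ^ 3 := by
  have := norm_cexp_mul_I_sub_sum_le 3 x
  have e : exp (x * I) - 1 - x * I + x ^ 2 / 2 =
      exp (x * I) - ∑ j ∈ Finset.range 3, (x * I) ^ j / (j.factorial : ℂ) := by
    simp [Finset.sum_range_succ, Nat.factorial, mul_pow]
    ring
  rwa [e]

open Complex in
theorem norm_cexp_mul_I_sub_cubic_le (x : ℝ) :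
    ‖exp (x * I) - 1 - x * I + x ^ 2 / 2 + x ^ 3 / 6 * I‖ ≤ x ^ 4 := by
  have := norm_cexp_mul_I_sub_sum_le 4 x
  have e : exp (x * I) - 1 - x * I + x ^ 2 / 2 + x ^ 3 / 6 * I =
      exp (x * I) - ∑ j ∈ Finset.range 4, (x * I) ^ j / (j.factorial : ℂ) := by
    simp [Finset.sum_range_succ, Nat.factorial, mul_pow, I_pow_three]
    ring
  rw [e]
  simpa [show |x| ^ 4 = x ^ 4 from (by decide : Even 4).pow_abs x] using this

/-! ### Moments of the Poisson weights and expansion on the circle -/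

/-- Factorial moments of the weights `r ^ k / k!`. -/
theorem hasSum_descFactorial_mul_pow_div_factorial (r : ℝ) (j : ℕ) :
    HasSum (fun k : ℕ => (k.descFactorial j : ℝ) * (r ^ k / k.factorial))
      (r ^ j * Real.exp r) := by
  have h0 : HasSum (fun k : ℕ => r ^ k / (k.factorial : ℝ)) (Real.exp r) := by
    rw [Real.exp_eq_exp_ℝ]
    exact NormedSpace.expSeries_div_hasSum_exp r
  have h1 := h0.mul_left (r ^ j)
  have hz : ∑ k ∈ Finset.range j, (k.descFactorial j : ℝ) * (r ^ k / k.factorial) = 0 := by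
    refine Finset.sum_eq_zero fun k hk => ?_
    rw [Nat.descFactorial_eq_zero_iff_lt.2 (Finset.mem_range.1 hk)]
    simp
  rw [← add_zero (r ^ j * Real.exp r), ← hz, ← hasSum_nat_add_iff j]
  convert! h1 using 2 with k
  have hk : ((k + j).factorial : ℝ) = k.factorial * (k + j).descFactorial j := by
    have := Nat.factorial_mul_descFactorial (Nat.le_add_left j k)
    rw [Nat.add_sub_cancel] at this
    exact_mod_cast this.symm
  have h2 : (k.factorial : ℝ) ≠ 0 := by exact_mod_cast k.factorial_ne_zero
  have h3 : ((k + j).descFactorial j : ℝ) ≠ 0 := by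
    have := Nat.descFactorial_eq_zero_iff_lt (n := k + j) (k := j)
    exact_mod_cast fun h => absurd (this.1 h) (by omega)
  rw [hk]
  field_simp
  ring

theorem cast_descFactorial_eq_mul_sub_one (k : ℕ) : (k.descFactorial 2 : ℝ) = k * (k - 1) := by
  rw [← descPochhammer_eval_eq_descFactorial]; simp [descPochhammer_succ_right]

theorem cast_descFactorial_three (k : ℕ) :
    (k.descFactorial 3 : ℝ) = k * (k - 1) * (k - 2) := by
  rw [← descPochhammer_eval_eq_descFactorial]; simp [descPochhammer_succ_right]

theorem cast_descFactorial_four (k : ℕ) :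
    (k.descFactorial 4 : ℝ) = k * (k - 1) * (k - 2) * (k - 3) := by
  rw [← descPochhammer_eval_eq_descFactorial]; simp [descPochhammer_succ_right]

theorem hasSum_pow_div_factorial (r : ℝ) :
    HasSum (fun k : ℕ => r ^ k / (k.factorial : ℝ)) (Real.exp r) := by
  simpa using hasSum_descFactorial_mul_pow_div_factorial r 0

theorem hasSum_first_moment (r : ℝ) :
    HasSum (fun k : ℕ => (k : ℝ) * (r ^ k / k.factorial)) (r * Real.exp r) := by
  simpa using hasSum_descFactorial_mul_pow_div_factorial r 1

theorem hasSum_second_moment (r : ℝ) :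
    HasSum (fun k : ℕ => (k : ℝ) ^ 2 * (r ^ k / k.factorial)) (r * (r + 1) * Real.exp r) := by
  have := (hasSum_descFactorial_mul_pow_div_factorial r 2).add (hasSum_first_moment r)
  convert! this using 1
  · ext k; rw [cast_descFactorial_eq_mul_sub_one]; ring
  · ring

theorem hasSum_third_moment (r : ℝ) :
    HasSum (fun k : ℕ => (k : ℝ) ^ 3 * (r ^ k / k.factorial))
      ((r ^ 3 + 3 * r ^ 2 + r) * Real.exp r) := by
  have := ((hasSum_descFactorial_mul_pow_div_factorial r 3).add
    ((hasSum_descFactorial_mul_pow_div_factorial r 2).mul_left 3)).add (hasSum_first_moment r)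
  convert! this using 1
  · ext k; rw [cast_descFactorial_eq_mul_sub_one, cast_descFactorial_three]; ring
  · ring

/-- The coefficients 1, 6, 7, 1 are the Stirling numbers that express `k ^ 4` in falling factorials.
-/
theorem hasSum_fourth_moment (r : ℝ) :
    HasSum (fun k : ℕ => (k : ℝ) ^ 4 * (r ^ k / k.factorial))
      ((r ^ 4 + 6 * r ^ 3 + 7 * r ^ 2 + r) * Real.exp r) := by
  have := (((hasSum_descFactorial_mul_pow_div_factorial r 4).add
    ((hasSum_descFactorial_mul_pow_div_factorial r 3).mul_left 6)).add
    ((hasSum_descFactorial_mul_pow_div_factorial r 2).mul_left 7)).add (hasSum_first_moment r)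
  convert! this using 1
  · ext k; rw [cast_descFactorial_eq_mul_sub_one, cast_descFactorial_three, cast_descFactorial_four]; ring
  · ring

open Complex in
theorem hasSum_cexp_circle (r θ : ℝ) :
    HasSum (fun k : ℕ => ((r ^ k / k.factorial : ℝ) : ℂ) * exp ((k * θ : ℝ) * I))
      (exp (r * exp (θ * I))) := by
  have : HasSum (fun k : ℕ => (r * exp (θ * I)) ^ k / (k.factorial : ℂ)) (exp (r * exp (θ * I))) := by
    rw [Complex.exp_eq_exp_ℂ]
    exact NormedSpace.expSeries_div_hasSum_exp _
  convert! this using 2 with k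
  rw [mul_pow, ← Complex.exp_nat_mul]
  push_cast
  rw [show (k : ℂ) * θ * I = k * (θ * I) by ring]
  ring

open Complex in
theorem hasSum_cexp_circle_sub_quadratic (r θ : ℝ) :
    HasSum (fun k : ℕ => ((r ^ k / k.factorial : ℝ) : ℂ) *
        (exp ((k * θ : ℝ) * I) - 1 - (k * θ : ℝ) * I + (k * θ : ℝ) ^ 2 / 2))
      (exp (r * exp (θ * I)) - exp r - (r * Real.exp r : ℝ) * θ * I
        + (r * (r + 1) * Real.exp r : ℝ) * θ ^ 2 / 2) := by
  have h0 := Complex.hasSum_ofReal.2 (hasSum_pow_div_factorial r)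
  have h1 := Complex.hasSum_ofReal.2 (hasSum_first_moment r)
  have h2 := Complex.hasSum_ofReal.2 (hasSum_second_moment r)
  have := (((hasSum_cexp_circle r θ).sub h0).sub (h1.mul_right (θ * I))).add
    (h2.mul_right ((θ : ℂ) ^ 2 / 2))
  convert! this using 1
  · ext k; push_cast; ring
  · push_cast; ring

-- Taylor's estimate is applied to each frequency `k θ` separately; the weights are nonnegative, so
-- the errors add up to a moment.
open Complex in
theorem norm_cexp_circle_sub_quadratic_le {r : ℝ} (hr : 0 ≤ r) (θ : ℝ) :
    ‖exp (r * exp (θ * I)) - exp r - (r * Real.exp r : ℝ) * θ * I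
        + (r * (r + 1) * Real.exp r : ℝ) * θ ^ 2 / 2‖ ≤
      (r ^ 3 + 3 * r ^ 2 + r) * Real.exp r * |θ| ^ 3 := by
  have h := hasSum_cexp_circle_sub_quadratic r θ
  rw [← h.tsum_eq]
  refine tsum_of_norm_bounded ((hasSum_third_moment r).mul_right (|θ| ^ 3)) fun k => ?_
  rw [norm_mul, Complex.norm_real, Real.norm_of_nonneg (by positivity)]
  refine (mul_le_mul_of_nonneg_left (norm_cexp_mul_I_sub_quadratic_le _) (by positivity)).trans ?_
  rw [abs_mul, Nat.abs_cast]
  exact le_of_eq (by ring)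

open Complex in
theorem norm_cexp_circle_sub_cubic_le {r : ℝ} (hr : 0 ≤ r) (θ : ℝ) :
    ‖exp (r * exp (θ * I)) - exp r - (r * Real.exp r : ℝ) * θ * I
        + (r * (r + 1) * Real.exp r : ℝ) * θ ^ 2 / 2
        + ((r ^ 3 + 3 * r ^ 2 + r) * Real.exp r : ℝ) * θ ^ 3 / 6 * I‖ ≤
      (r ^ 4 + 6 * r ^ 3 + 7 * r ^ 2 + r) * Real.exp r * θ ^ 4 := by
  have h3 := Complex.hasSum_ofReal.2 (hasSum_third_moment r)
  have h := (hasSum_cexp_circle_sub_quadratic r θ).add (h3.mul_right ((θ : ℂ) ^ 3 / 6 * I))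
  rw [show ((r ^ 3 + 3 * r ^ 2 + r) * Real.exp r : ℝ) * (θ : ℂ) ^ 3 / 6 * I =
    ((r ^ 3 + 3 * r ^ 2 + r) * Real.exp r : ℝ) * ((θ : ℂ) ^ 3 / 6 * I) by ring, ← h.tsum_eq]
  refine tsum_of_norm_bounded ((hasSum_fourth_moment r).mul_right (θ ^ 4)) fun k => ?_
  have e : ((r ^ k / k.factorial : ℝ) : ℂ) *
        (exp ((k * θ : ℝ) * I) - 1 - (k * θ : ℝ) * I + (k * θ : ℝ) ^ 2 / 2) +
        (((k : ℝ) ^ 3 * (r ^ k / k.factorial) : ℝ) : ℂ) * ((θ : ℂ) ^ 3 / 6 * I) =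
      ((r ^ k / k.factorial : ℝ) : ℂ) * (exp ((k * θ : ℝ) * I) - 1 - (k * θ : ℝ) * I +
        (k * θ : ℝ) ^ 2 / 2 + (k * θ : ℝ) ^ 3 / 6 * I) := by
    push_cast; ring
  rw [e, norm_mul, Complex.norm_real, Real.norm_of_nonneg (by positivity)]
  refine (mul_le_mul_of_nonneg_left (norm_cexp_mul_I_sub_cubic_le _) (by positivity)).trans ?_
  exact le_of_eq (by ring)

/-! ### The phase and its expansion at the saddle point -/

/-- The moments of the weights `r ^ k / k!` over a finite set of indices. -/
noncomputable def weightMoment (T : Finset ℕ) (r : ℝ) (j : ℕ) : ℝ :=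
  ∑ k ∈ T, (k : ℝ) ^ j * (r ^ k / k.factorial)

theorem weightMoment_nonneg (T : Finset ℕ) {r : ℝ} (hr : 0 ≤ r) (j : ℕ) :
    0 ≤ weightMoment T r j :=
  Finset.sum_nonneg fun k _ => by positivity

/-- The logarithm of the normalised Cauchy integrand on the circle of radius `r`. -/
noncomputable def phase (T : Finset ℕ) (r θ : ℝ) : ℂ :=
  blockEGF T (r * Complex.exp (θ * Complex.I)) - blockEGF T r
    - (r * Real.exp r : ℝ) * θ * Complex.I

open Complex in
/-- The contribution to `phase` of the excluded block sizes. -/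
noncomputable def excludedPhase (T : Finset ℕ) (r θ : ℝ) : ℂ :=
  ∑ k ∈ T, ((r ^ k / k.factorial : ℝ) : ℂ) * (exp ((k * θ : ℝ) * I) - 1)

open Complex in
theorem phase_eq (T : Finset ℕ) (r θ : ℝ) :
    phase T r θ = exp (r * exp (θ * I)) - exp r - (r * Real.exp r : ℝ) * θ * I
      - excludedPhase T r θ := by
  have h : excludedPhase T r θ = ∑ k ∈ T, ((r : ℂ) * exp (θ * I)) ^ k / (k.factorial : ℂ) -
      ∑ k ∈ T, (r : ℂ) ^ k / (k.factorial : ℂ) := by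
    rw [excludedPhase, ← Finset.sum_sub_distrib]
    refine Finset.sum_congr rfl fun k _ => ?_
    rw [mul_pow, ← Complex.exp_nat_mul]
    push_cast
    rw [show (k : ℂ) * θ * I = k * (θ * I) by ring]
    ring
  rw [h, phase, blockEGF, blockEGF]
  ring

theorem norm_excludedPhase_le (T : Finset ℕ) {r : ℝ} (hr : 0 ≤ r) (θ : ℝ) :
    ‖excludedPhase T r θ‖ ≤ weightMoment T r 1 * |θ| := by
  rw [excludedPhase, weightMoment, Finset.sum_mul]
  refine norm_sum_le_of_le _ fun k _ => ?_
  rw [norm_mul, Complex.norm_real, Real.norm_of_nonneg (by positivity)]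
  refine (mul_le_mul_of_nonneg_left (norm_cexp_mul_I_sub_one_le _) (by positivity)).trans ?_
  rw [abs_mul, Nat.abs_cast]
  exact le_of_eq (by ring)

theorem norm_excludedPhase_le_two_mul {T : Finset ℕ} (hT : 0 ∉ T) {r : ℝ} (hr : 0 ≤ r) (θ : ℝ) :
    ‖excludedPhase T r θ‖ ≤ 2 * weightMoment T r 1 := by
  rw [excludedPhase, weightMoment, Finset.mul_sum]
  refine norm_sum_le_of_le _ fun k hk => ?_
  have hk1 : (1 : ℝ) ≤ k := by
    exact_mod_cast Nat.one_le_iff_ne_zero.2 fun h => hT (h ▸ hk)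
  rw [norm_mul, Complex.norm_real, Real.norm_of_nonneg (by positivity)]
  have h2 : ‖Complex.exp ((k * θ : ℝ) * Complex.I) - 1‖ ≤ 2 := by
    refine (norm_sub_le _ _).trans ?_
    rw [Complex.norm_exp_ofReal_mul_I]
    norm_num
  have hp : 0 ≤ r ^ k / (k.factorial : ℝ) := by positivity
  nlinarith [mul_le_mul_of_nonneg_left h2 hp, mul_nonneg hp (sub_nonneg.2 hk1)]

open Complex in
theorem norm_excludedPhase_sub_le (T : Finset ℕ) {r : ℝ} (hr : 0 ≤ r) (θ : ℝ) :
    ‖excludedPhase T r θ - weightMoment T r 1 * θ * I‖ ≤ weightMoment T r 2 * θ ^ 2 := by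
  have e : excludedPhase T r θ - weightMoment T r 1 * θ * I =
      ∑ k ∈ T, ((r ^ k / k.factorial : ℝ) : ℂ) *
        (exp ((k * θ : ℝ) * I) - 1 - (k * θ : ℝ) * I) := by
    rw [excludedPhase, weightMoment]
    push_cast
    rw [Finset.sum_mul, Finset.sum_mul, ← Finset.sum_sub_distrib]
    exact Finset.sum_congr rfl fun k _ => by ring
  rw [e, weightMoment, Finset.sum_mul]
  refine norm_sum_le_of_le _ fun k _ => ?_
  rw [norm_mul, Complex.norm_real, Real.norm_of_nonneg (by positivity)]
  refine (mul_le_mul_of_nonneg_left (norm_cexp_mul_I_sub_linear_le _) (by positivity)).trans ?_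
  exact le_of_eq (by ring)

/-- The variance `r (r + 1) e ^ r` of the saddle point approximation. -/
noncomputable def saddleVariance (r : ℝ) : ℝ := r * (r + 1) * Real.exp r

theorem norm_phase_add_quadratic_le (T : Finset ℕ) {r : ℝ} (hr : 0 ≤ r) (θ : ℝ) :
    ‖phase T r θ + saddleVariance r * θ ^ 2 / 2‖ ≤
      (r ^ 3 + 3 * r ^ 2 + r) * Real.exp r * |θ| ^ 3 + weightMoment T r 1 * |θ| := by
  rw [phase_eq, saddleVariance, sub_add_eq_add_sub]
  exact (norm_sub_le _ _).trans
    (add_le_add (norm_cexp_circle_sub_quadratic_le hr θ) (norm_excludedPhase_le T hr θ))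

open Complex in
theorem norm_phase_add_cubic_le (T : Finset ℕ) {r : ℝ} (hr : 0 ≤ r) (θ : ℝ) :
    ‖phase T r θ + saddleVariance r * θ ^ 2 / 2
        + ((r ^ 3 + 3 * r ^ 2 + r) * Real.exp r : ℝ) * θ ^ 3 / 6 * I
        + weightMoment T r 1 * θ * I‖ ≤
      (r ^ 4 + 6 * r ^ 3 + 7 * r ^ 2 + r) * Real.exp r * θ ^ 4 + weightMoment T r 2 * θ ^ 2 := by
  rw [phase_eq, saddleVariance]
  have := (norm_sub_le _ _).trans
    (add_le_add (norm_cexp_circle_sub_cubic_le hr θ) (norm_excludedPhase_sub_le T hr θ))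
  refine le_of_eq_of_le ?_ this
  congr 1
  ring

/-- The linear and cubic terms are odd and cancel. This is what makes the final error quadratic in
`Q e ^ (-r / 2)`. -/
theorem norm_phase_symm_le (T : Finset ℕ) {r : ℝ} (hr : 0 ≤ r) (θ : ℝ) :
    ‖(phase T r θ + saddleVariance r * θ ^ 2 / 2)
        + (phase T r (-θ) + saddleVariance r * θ ^ 2 / 2)‖ ≤
      2 * ((r ^ 4 + 6 * r ^ 3 + 7 * r ^ 2 + r) * Real.exp r * θ ^ 4
        + weightMoment T r 2 * θ ^ 2) := by
  have h1 := norm_phase_add_cubic_le T hr θ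
  have h2 := norm_phase_add_cubic_le T hr (-θ)
  rw [neg_sq, (by decide : Even 4).neg_pow] at h2
  refine le_trans (le_of_eq_of_le ?_ (norm_add_le _ _)) ((add_le_add h1 h2).trans_eq (by ring))
  congr 1
  push_cast
  ring

/-! ### Decay of the integrand -/

theorem re_cexp_circle (r θ : ℝ) :
    (Complex.exp (r * Complex.exp (θ * Complex.I))).re =
      Real.exp (r * Real.cos θ) * Real.cos (r * Real.sin θ) := by
  rw [Complex.exp_re]
  simp [Complex.exp_ofReal_mul_I_re, Complex.exp_ofReal_mul_I_im]

theorem re_phase (T : Finset ℕ) (r θ : ℝ) :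
    (phase T r θ).re = Real.exp (r * Real.cos θ) * Real.cos (r * Real.sin θ) - Real.exp r
      - (excludedPhase T r θ).re := by
  rw [phase_eq, Complex.sub_re, Complex.sub_re, Complex.sub_re, re_cexp_circle, Complex.exp_ofReal_re]
  simp

/-- Here `|r sin θ| ≤ 1`, and the factor `cos (r sin θ)` alone provides a loss of `r ^ 2 θ ^ 2 e ^ r
/ 16`, at least `A θ ^ 2 / 32`. The excluded sizes use up at most half of it, their linear term
being imaginary. -/
theorem re_phase_le_of_abs_le {T : Finset ℕ} {r : ℝ} (hr : 1 ≤ r)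
    (hE : weightMoment T r 2 ≤ saddleVariance r / 64) {θ : ℝ} (hθ : |θ| ≤ 1 / r) :
    (phase T r θ).re ≤ -(saddleVariance r * θ ^ 2 / 64) := by
  have hr0 : 0 < r := by linarith
  have hpi3 := Real.pi_gt_three
  have hpi4 : Real.pi < 3.15 := Real.pi_lt_d2
  have hθ1 : |θ| ≤ 1 := hθ.trans (by rw [div_le_one hr0]; exact hr)
  have hrθ : r * |θ| ≤ 1 := by rwa [le_div_iff₀ hr0, mul_comm] at hθ
  have hs : |r * Real.sin θ| ≤ 1 := by
    rw [abs_mul, abs_of_pos hr0]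
    exact (mul_le_mul_of_nonneg_left Real.abs_sin_le_abs hr0.le).trans hrθ
  have hc0 : 0 ≤ Real.cos (r * Real.sin θ) :=
    Real.cos_nonneg_of_neg_pi_div_two_le_of_le (by linarith [(abs_le.1 hs).1])
      (by linarith [(abs_le.1 hs).2])
  have hc1 := Real.cos_le_one_sub_mul_cos_sq (x := r * Real.sin θ) (by linarith)
  have hsin := Real.mul_abs_le_abs_sin (x := θ) (by linarith)
  have hsin2 : (2 / Real.pi) ^ 2 * θ ^ 2 ≤ Real.sin θ ^ 2 := by
    have := pow_le_pow_left₀ (by positivity) hsin 2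
    rwa [mul_pow, sq_abs, sq_abs] at this
  have hq : (1 : ℝ) / 16 ≤ 2 / Real.pi ^ 2 * (2 / Real.pi) ^ 2 := by
    have : Real.pi ^ 2 ≤ 10 := by nlinarith
    rw [div_pow, div_mul_div_comm, div_le_div_iff₀ (by norm_num) (by positivity)]
    nlinarith [sq_nonneg Real.pi]
  have hc2 : Real.cos (r * Real.sin θ) ≤ 1 - r ^ 2 * θ ^ 2 / 16 := by
    have h1 : 2 / Real.pi ^ 2 * ((2 / Real.pi) ^ 2 * θ ^ 2) * r ^ 2 ≤
        2 / Real.pi ^ 2 * Real.sin θ ^ 2 * r ^ 2 := by gcongr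
    have h2 := mul_le_mul_of_nonneg_right hq (by positivity : 0 ≤ θ ^ 2 * r ^ 2)
    rw [mul_pow] at hc1
    linarith
  have he : Real.exp (r * Real.cos θ) ≤ Real.exp r :=
    Real.exp_le_exp.2 (mul_le_of_le_one_right hr0.le (Real.cos_le_one θ))
  have h3 : Real.exp (r * Real.cos θ) * Real.cos (r * Real.sin θ) ≤
      Real.exp r * (1 - r ^ 2 * θ ^ 2 / 16) :=
    mul_le_mul he hc2 hc0 (Real.exp_pos r).le
  have h4 : -(excludedPhase T r θ).re ≤ weightMoment T r 2 * θ ^ 2 := by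
    have h := norm_excludedPhase_sub_le T hr0.le θ
    have h5 := (Complex.abs_re_le_norm _).trans h
    have h6 : (excludedPhase T r θ - weightMoment T r 1 * θ * Complex.I).re =
        (excludedPhase T r θ).re := by simp
    rw [h6] at h5
    exact (neg_le_abs _).trans h5
  have h7 : weightMoment T r 2 * θ ^ 2 ≤ saddleVariance r / 64 * θ ^ 2 := by gcongr
  have h8 : saddleVariance r ≤ 2 * r ^ 2 * Real.exp r := by
    have h : r * (r + 1) ≤ 2 * r ^ 2 := by nlinarith
    exact mul_le_mul_of_nonneg_right h (Real.exp_pos r).le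
  have h9 := mul_le_mul_of_nonneg_right h8 (sq_nonneg θ)
  rw [re_phase]
  linarith

/-- Away from the saddle point the modulus of `exp (r e ^ (i θ))` is already smaller than `e ^ r` by
a factor `1 - 1 / (10 r)`, because `cos θ ≤ 1 - 1 / (5 r ^ 2)`. -/
theorem re_phase_le_of_le_abs {T : Finset ℕ} (hT : 0 ∉ T) {r : ℝ} (hr : 1 ≤ r)
    {θ : ℝ} (hθ : 1 / r ≤ |θ|) (hθpi : |θ| ≤ Real.pi) :
    (phase T r θ).re ≤ -(Real.exp r / (10 * r)) + 2 * weightMoment T r 1 := by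
  have hr0 : 0 < r := by linarith
  have hpi4 : Real.pi < 3.15 := Real.pi_lt_d2
  have hpi0 := Real.pi_pos
  have hc := Real.cos_le_one_sub_mul_cos_sq hθpi
  have hθ2 : 1 / r ^ 2 ≤ θ ^ 2 := by
    have := pow_le_pow_left₀ (by positivity) hθ 2
    rwa [sq_abs, div_pow, one_pow] at this
  have hq : (1 : ℝ) / 5 ≤ 2 / Real.pi ^ 2 := by
    rw [div_le_div_iff₀ (by norm_num) (by positivity)]
    nlinarith
  have h1 : r * Real.cos θ ≤ r - 1 / (5 * r) := by
    have : 1 / 5 * (1 / r ^ 2) ≤ 2 / Real.pi ^ 2 * θ ^ 2 := by gcongr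
    have h2 : Real.cos θ ≤ 1 - 1 / 5 * (1 / r ^ 2) := by linarith
    have := mul_le_mul_of_nonneg_left h2 hr0.le
    refine this.trans_eq ?_
    field_simp
  have hx : Real.exp (-(1 / (5 * r))) ≤ 1 - 1 / (10 * r) := by
    have hy0 : 0 ≤ 1 / (10 * r) := by positivity
    have hy1 : 1 / (10 * r) ≤ 1 / 10 := by
      rw [div_le_div_iff₀ (by positivity) (by norm_num)]; linarith
    have e : 1 / (5 * r) = 2 * (1 / (10 * r)) := by field_simp; norm_num
    rw [e]
    set y := 1 / (10 * r)
    rw [Real.exp_neg]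
    refine inv_le_of_inv_le₀ (by linarith) ?_
    have := Real.add_one_le_exp (2 * y)
    refine le_trans ?_ this
    rw [inv_le_iff_one_le_mul₀ (by linarith)]
    nlinarith
  have h3 : Real.exp (r * Real.cos θ) ≤ Real.exp r * (1 - 1 / (10 * r)) := by
    refine (Real.exp_le_exp.2 h1).trans ?_
    rw [sub_eq_add_neg, Real.exp_add]
    gcongr
  have h4 : Real.exp (r * Real.cos θ) * Real.cos (r * Real.sin θ) ≤ Real.exp (r * Real.cos θ) :=
    mul_le_of_le_one_right (Real.exp_pos _).le (Real.cos_le_one _)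
  have h5 : -(excludedPhase T r θ).re ≤ 2 * weightMoment T r 1 :=
    (neg_le_abs _).trans ((Complex.abs_re_le_norm _).trans
      (norm_excludedPhase_le_two_mul hT hr0.le θ))
  rw [re_phase]
  have e6 : Real.exp r * (1 - 1 / (10 * r)) = Real.exp r - Real.exp r / (10 * r) := by ring
  linarith

/-! ### Comparison with the Gaussian -/

/-- Taylor's estimate for `exp w` is multiplied by `exp (-u)`. The perturbation `w` need not be
small: only the real part of the whole exponent matters. -/
theorem norm_cexp_sub_gaussian_le (u : ℝ) (w : ℂ) {c : ℝ} (hc : -u ≤ c) (hw : (w - u).re ≤ c) :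
    ‖Complex.exp (w - u) - Real.exp (-u) * (1 + w)‖ ≤ ‖w‖ ^ 2 * Real.exp c := by
  have h := norm_cexp_sub_sum_le 2 w
  have e : Complex.exp (w - u) - Real.exp (-u) * (1 + w) = Real.exp (-u) *
      (Complex.exp w - ∑ j ∈ Finset.range 2, w ^ j / (j.factorial : ℂ)) := by
    rw [sub_eq_add_neg w, Complex.exp_add]
    simp [Finset.sum_range_succ]
    ring
  rw [e, norm_mul, Complex.norm_real, Real.norm_of_nonneg (Real.exp_pos _).le]
  calc Real.exp (-u) * _ ≤ Real.exp (-u) * (‖w‖ ^ 2 * max 1 (Real.exp w.re)) := by gcongr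
    _ = ‖w‖ ^ 2 * max (Real.exp (-u)) (Real.exp (w - u).re) := by
        rw [mul_left_comm, mul_max_of_nonneg _ _ (Real.exp_pos _).le, mul_one, ← Real.exp_add]
        have : (w - u).re = -u + w.re := by simp; ring
        rw [this]
    _ ≤ ‖w‖ ^ 2 * Real.exp c := by
        gcongr
        exact max_le (Real.exp_le_exp.2 hc) (Real.exp_le_exp.2 hw)

theorem pow_mul_exp_neg_le_factorial {y : ℝ} (hy : 0 ≤ y) (j : ℕ) :
    y ^ j * Real.exp (-y) ≤ j.factorial := by
  have h := Real.pow_div_factorial_le_exp y hy j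
  rw [div_le_iff₀ (by positivity)] at h
  rw [Real.exp_neg, ← div_eq_mul_inv, div_le_iff₀ (Real.exp_pos y), mul_comm]
  exact h

/-- Half of the decay pays for the powers of `θ`; each `θ ^ 2` costs a factor of order `1 / A`. -/
theorem pow_mul_exp_neg_mul_sq_le {A : ℝ} (hA : 0 < A) (θ : ℝ) (j : ℕ) :
    θ ^ (2 * j) * Real.exp (-(A * θ ^ 2 / 64)) ≤
      j.factorial * (128 / A) ^ j * Real.exp (-(A * θ ^ 2 / 128)) := by
  have h := pow_mul_exp_neg_le_factorial (y := A * θ ^ 2 / 128) (by positivity) j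
  have e : θ ^ (2 * j) = (128 / A) ^ j * (A * θ ^ 2 / 128) ^ j := by
    rw [← mul_pow, pow_mul]
    congr 1
    field_simp
  have e2 : Real.exp (-(A * θ ^ 2 / 64)) =
      Real.exp (-(A * θ ^ 2 / 128)) * Real.exp (-(A * θ ^ 2 / 128)) := by
    rw [← Real.exp_add]; ring_nf
  rw [e, e2]
  calc _ = ((A * θ ^ 2 / 128) ^ j * Real.exp (-(A * θ ^ 2 / 128))) * ((128 / A) ^ j *
        Real.exp (-(A * θ ^ 2 / 128))) := by ring
    _ ≤ j.factorial * ((128 / A) ^ j * Real.exp (-(A * θ ^ 2 / 128))) := by gcongr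
    _ = _ := by ring

theorem saddleVariance_pos {r : ℝ} (hr : 0 < r) : 0 < saddleVariance r := by
  unfold saddleVariance; positivity

theorem sq_mul_exp_le_saddleVariance {r : ℝ} (hr : 0 ≤ r) :
    r ^ 2 * Real.exp r ≤ saddleVariance r :=
  mul_le_mul_of_nonneg_right (by nlinarith) (Real.exp_pos r).le

theorem norm_cexp_phase_sub_le_of_abs_le {T : Finset ℕ} {r : ℝ} (hr : 1 ≤ r)
    (hE : weightMoment T r 2 ≤ saddleVariance r / 64) {θ : ℝ} (hθ : |θ| ≤ 1 / r) :
    ‖Complex.exp (phase T r θ) - Real.exp (-(saddleVariance r * θ ^ 2 / 2)) *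
        (1 + (phase T r θ + saddleVariance r * θ ^ 2 / 2))‖ ≤
      (2 * ((r ^ 3 + 3 * r ^ 2 + r) * Real.exp r) ^ 2 * θ ^ 6 + 2 * weightMoment T r 1 ^ 2 * θ ^ 2) *
        Real.exp (-(saddleVariance r * θ ^ 2 / 64)) := by
  have hr0 : 0 < r := by linarith
  have hA := saddleVariance_pos hr0
  have h1 := norm_phase_add_quadratic_le T hr0.le θ
  have h2 := norm_cexp_sub_gaussian_le (saddleVariance r * θ ^ 2 / 2)
    (phase T r θ + saddleVariance r * θ ^ 2 / 2) (c := -(saddleVariance r * θ ^ 2 / 64))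
    (by nlinarith [mul_nonneg hA.le (sq_nonneg θ)]) (by
      have := re_phase_le_of_abs_le hr hE hθ
      simpa using this)
  have e : phase T r θ + saddleVariance r * θ ^ 2 / 2 - (saddleVariance r * θ ^ 2 / 2 : ℝ) =
      phase T r θ := by push_cast; ring
  rw [e] at h2
  refine h2.trans ?_
  gcongr
  refine (pow_le_pow_left₀ (norm_nonneg _) h1 2).trans ?_
  refine add_sq_le.trans_eq ?_
  have e6 : (|θ| ^ 3) ^ 2 = θ ^ 6 := by rw [← pow_mul, (by decide : Even (3 * 2)).pow_abs]
  rw [mul_pow _ (|θ| ^ 3), mul_pow _ |θ|, sq_abs, e6]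
  ring

theorem third_moment_poly_le {r : ℝ} (hr : 1 ≤ r) : r ^ 3 + 3 * r ^ 2 + r ≤ 5 * r ^ 3 := by
  linarith [pow_le_pow_right₀ hr (show 1 ≤ 3 by norm_num),
    pow_le_pow_right₀ hr (show 2 ≤ 3 by norm_num)]

theorem fourth_moment_poly_le {r : ℝ} (hr : 1 ≤ r) :
    r ^ 4 + 6 * r ^ 3 + 7 * r ^ 2 + r ≤ 15 * r ^ 4 := by
  linarith [pow_le_pow_right₀ hr (show 1 ≤ 4 by norm_num),
    pow_le_pow_right₀ hr (show 2 ≤ 4 by norm_num), pow_le_pow_right₀ hr (show 3 ≤ 4 by norm_num)]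

/-- With `θ ^ 2` traded for `1 / A ≤ 1 / (r ^ 2 e ^ r)`, the four errors become `K₃ ^ 2 / A ^ 3` and
`K₄ / A ^ 2`, both `O(e ^ (-r))`, and `D ^ 2 / A` and `E / A`, which are `O(Q ^ 2 / e ^ r)` and `O(Q
/ e ^ r)`. As `Q ≥ 1`, `Q ^ 2 / e ^ r` dominates all of them. -/
theorem norm_symm_cexp_phase_sub_le {T : Finset ℕ} {r Q : ℝ} (hr : 1 ≤ r) (hQ : 1 ≤ Q)
    (hD : weightMoment T r 1 ≤ 3 * r * Q) (hE : weightMoment T r 2 ≤ 3 * r ^ 2 * Q)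
    (hEA : weightMoment T r 2 ≤ saddleVariance r / 64) {θ : ℝ} (hθ : |θ| ≤ 1 / r) :
    ‖(Complex.exp (phase T r θ) + Complex.exp (phase T r (-θ))) / 2 -
        Real.exp (-(saddleVariance r * θ ^ 2 / 2))‖ ≤
      (2000 * 128 ^ 3) * (Q ^ 2 / Real.exp r) * Real.exp (-(saddleVariance r * θ ^ 2 / 128)) := by
  have hr0 : 0 < r := by linarith
  set A := saddleVariance r with hAdef
  have hA : 0 < A := saddleVariance_pos hr0
  have hAr : r ^ 2 * Real.exp r ≤ A := sq_mul_exp_le_saddleVariance hr0.le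
  set K₃ := (r ^ 3 + 3 * r ^ 2 + r) * Real.exp r with hK₃
  set K₄ := (r ^ 4 + 6 * r ^ 3 + 7 * r ^ 2 + r) * Real.exp r with hK₄
  set D := weightMoment T r 1
  set E := weightMoment T r 2
  have hD0 : 0 ≤ D := weightMoment_nonneg T hr0.le 1
  have hE0 : 0 ≤ E := weightMoment_nonneg T hr0.le 2
  have hexp := Real.exp_pos r
  have h1 := norm_cexp_phase_sub_le_of_abs_le hr hEA hθ
  have h2 := norm_cexp_phase_sub_le_of_abs_le hr hEA (θ := -θ) (by rwa [abs_neg])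
  simp only [Complex.ofReal_neg, neg_sq, (by decide : Even 6).neg_pow] at h2
  have h3 := norm_phase_symm_le T hr0.le θ
  set G := Real.exp (-(A * θ ^ 2 / 2)) with hG
  set H₁ := phase T r θ + A * θ ^ 2 / 2
  set H₂ := phase T r (-θ) + A * θ ^ 2 / 2
  have hGle : G ≤ Real.exp (-(A * θ ^ 2 / 64)) :=
    Real.exp_le_exp.2 (by nlinarith [mul_nonneg hA.le (sq_nonneg θ)])
  have hsplit : (Complex.exp (phase T r θ) + Complex.exp (phase T r (-θ))) / 2 - G =
      ((Complex.exp (phase T r θ) - G * (1 + H₁)) + (Complex.exp (phase T r (-θ)) - G * (1 + H₂))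
        + G * (H₁ + H₂)) / 2 := by ring
  have h4 : ‖(G : ℂ) * (H₁ + H₂)‖ ≤
      2 * (K₄ * θ ^ 4 + E * θ ^ 2) * Real.exp (-(A * θ ^ 2 / 64)) := by
    rw [norm_mul, Complex.norm_real, Real.norm_of_nonneg (Real.exp_pos _).le, mul_comm]
    exact mul_le_mul h3 hGle (Real.exp_pos _).le (by positivity)
  have h5 : ‖(Complex.exp (phase T r θ) + Complex.exp (phase T r (-θ))) / 2 - G‖ ≤
      (2 * K₃ ^ 2 * θ ^ 6 + 2 * D ^ 2 * θ ^ 2 + (K₄ * θ ^ 4 + E * θ ^ 2)) *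
        Real.exp (-(A * θ ^ 2 / 64)) := by
    rw [hsplit, norm_div, Complex.norm_ofNat, div_le_iff₀ (by norm_num)]
    refine (norm_add₃_le.trans (add_le_add (add_le_add h1 h2) h4)).trans_eq ?_
    ring
  refine h5.trans ?_
  have m1 := pow_mul_exp_neg_mul_sq_le hA θ 1
  have m2 := pow_mul_exp_neg_mul_sq_le hA θ 2
  have m3 := pow_mul_exp_neg_mul_sq_le hA θ 3
  set X := Real.exp (-(A * θ ^ 2 / 64))
  set Y := Real.exp (-(A * θ ^ 2 / 128)) with hY
  have hY0 : 0 < Y := Real.exp_pos _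
  norm_num at m1 m2 m3
  have hQ2 : Q ≤ Q ^ 2 := by nlinarith
  have hQ21 : 1 ≤ Q ^ 2 := by nlinarith
  have b3 : K₃ ≤ 5 * r ^ 3 * Real.exp r :=
    mul_le_mul_of_nonneg_right (third_moment_poly_le hr) hexp.le
  have b4 : K₄ ≤ 15 * r ^ 4 * Real.exp r :=
    mul_le_mul_of_nonneg_right (fourth_moment_poly_le hr) hexp.le
  have hinv : 1 / A ≤ 1 / (r ^ 2 * Real.exp r) := by gcongr
  have q1 : D ^ 2 * (1 / A) ≤ 9 * (Q ^ 2 / Real.exp r) := by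
    calc D ^ 2 * (1 / A) ≤ (3 * r * Q) ^ 2 * (1 / (r ^ 2 * Real.exp r)) := by gcongr
      _ = _ := by field_simp; norm_num
  have q2 : E * (1 / A) ≤ 3 * (Q ^ 2 / Real.exp r) := by
    calc E * (1 / A) ≤ (3 * r ^ 2 * Q ^ 2) * (1 / (r ^ 2 * Real.exp r)) := by
          gcongr
          exact hE.trans (by gcongr)
      _ = _ := by field_simp
  have q3 : K₃ ^ 2 * (1 / A) ^ 3 ≤ 25 * (Q ^ 2 / Real.exp r) := by
    calc K₃ ^ 2 * (1 / A) ^ 3 ≤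
          (5 * r ^ 3 * Real.exp r) ^ 2 * (1 / (r ^ 2 * Real.exp r)) ^ 3 := by gcongr
      _ = 25 * (1 / Real.exp r) := by field_simp; norm_num
      _ ≤ _ := by gcongr
  have q4 : K₄ * (1 / A) ^ 2 ≤ 15 * (Q ^ 2 / Real.exp r) := by
    calc K₄ * (1 / A) ^ 2 ≤
          (15 * r ^ 4 * Real.exp r) * (1 / (r ^ 2 * Real.exp r)) ^ 2 := by gcongr
      _ = 15 * (1 / Real.exp r) := by field_simp
      _ ≤ _ := by gcongr
  set W := Q ^ 2 / Real.exp r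
  have hW : 0 ≤ W := by positivity
  calc (2 * K₃ ^ 2 * θ ^ 6 + 2 * D ^ 2 * θ ^ 2 + (K₄ * θ ^ 4 + E * θ ^ 2)) * X
      = 2 * K₃ ^ 2 * (θ ^ 6 * X) + 2 * D ^ 2 * (θ ^ 2 * X) + K₄ * (θ ^ 4 * X)
          + E * (θ ^ 2 * X) := by ring
    _ ≤ 2 * K₃ ^ 2 * (6 * (128 / A) ^ 3 * Y) + 2 * D ^ 2 * (128 / A * Y)
          + K₄ * (2 * (128 / A) ^ 2 * Y) + E * (128 / A * Y) := by
        gcongr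
    _ = (12 * 128 ^ 3 * (K₃ ^ 2 * (1 / A) ^ 3) + 2 * 128 * (D ^ 2 * (1 / A))
          + 2 * 128 ^ 2 * (K₄ * (1 / A) ^ 2) + 128 * (E * (1 / A))) * Y := by ring
    _ ≤ (12 * 128 ^ 3 * (25 * W) + 2 * 128 * (9 * W) + 2 * 128 ^ 2 * (15 * W)
          + 128 * (3 * W)) * Y := by gcongr
    _ ≤ (2000 * 128 ^ 3) * W * Y := by gcongr; linarith

/-- In this range `A θ ^ 2 ≥ e ^ r`, so part of the exponent yields `exp (-e ^ r / 4) ≤ 4 / e ^ r`.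
-/
theorem exp_neg_saddleVariance_mul_sq_le {r : ℝ} (hr : 1 ≤ r) {θ : ℝ} (hθ : 1 / r ≤ |θ|) :
    Real.exp (-(saddleVariance r * θ ^ 2 / 2)) ≤
      4 * (1 / Real.exp r) * Real.exp (-(saddleVariance r * θ ^ 2 / 128)) := by
  have hr0 : 0 < r := by linarith
  have hA := saddleVariance_pos hr0
  have hθ2 : 1 / r ^ 2 ≤ θ ^ 2 := by
    have := pow_le_pow_left₀ (by positivity) hθ 2
    rwa [sq_abs, div_pow, one_pow] at this
  have h1 : Real.exp r ≤ saddleVariance r * θ ^ 2 := by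
    calc Real.exp r = r ^ 2 * Real.exp r * (1 / r ^ 2) := by field_simp
      _ ≤ saddleVariance r * θ ^ 2 := by
        gcongr
        exact sq_mul_exp_le_saddleVariance hr0.le
  have h2 := pow_mul_exp_neg_le_factorial (y := Real.exp r / 4) (by positivity) 1
  have h3 : Real.exp (-(Real.exp r / 4)) ≤ 4 * (1 / Real.exp r) := by
    rw [mul_one_div, le_div_iff₀ (Real.exp_pos r)]
    norm_num at h2
    linarith
  refine le_trans ?_ (mul_le_mul_of_nonneg_right h3 (Real.exp_pos _).le)
  rw [← Real.exp_add]
  refine Real.exp_le_exp.2 ?_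
  nlinarith [Real.exp_pos r]

/-! ### Integration over the circle -/

open MeasureTheory

theorem continuous_phase (T : Finset ℕ) (r : ℝ) : Continuous (phase T r) := by
  have := (contDiff_blockEGF T).continuous
  unfold phase
  fun_prop

theorem integral_symm_cexp_phase (T : Finset ℕ) (r : ℝ) :
    ∫ θ in (-Real.pi)..Real.pi,
        (Complex.exp (phase T r θ) + Complex.exp (phase T r (-θ))) / 2 =
      ∫ θ in (-Real.pi)..Real.pi, Complex.exp (phase T r θ) := by
  have hc : Continuous fun θ => Complex.exp (phase T r θ) :=
    Complex.continuous_exp.comp (continuous_phase T r)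
  have hc' : Continuous fun θ => Complex.exp (phase T r (-θ)) := hc.comp continuous_neg
  have hneg := intervalIntegral.integral_comp_neg (a := -Real.pi) (b := Real.pi)
    (fun θ => Complex.exp (phase T r θ))
  rw [neg_neg] at hneg
  rw [intervalIntegral.integral_div, intervalIntegral.integral_add
    (hc.intervalIntegrable _ _) (hc'.intervalIntegrable _ _), hneg]
  ring

theorem integrable_gaussian_div {A : ℝ} (hA : 0 < A) (c : ℝ) (hc : 0 < c) :
    Integrable fun θ : ℝ => Real.exp (-(A * θ ^ 2 / c)) := by
  have := integrable_exp_neg_mul_sq (b := A / c) (by positivity)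
  convert! this using 3
  ring

theorem integral_gaussian_div (A c : ℝ) :
    ∫ θ : ℝ, Real.exp (-(A * θ ^ 2 / c)) = √(c * Real.pi / A) := by
  have := integral_gaussian (A / c)
  rw [div_div_eq_mul_div, mul_comm] at this
  rw [← this]
  congr 1
  ext θ
  congr 1
  ring

theorem intervalIntegral_gaussian_le {A c : ℝ} (hA : 0 < A) (hc : 0 < c) :
    ∫ θ in (-Real.pi)..Real.pi, Real.exp (-(A * θ ^ 2 / c)) ≤ √(c * Real.pi / A) := by
  rw [intervalIntegral.integral_of_le (by linarith [Real.pi_pos]), ← integral_gaussian_div]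
  exact setIntegral_le_integral (integrable_gaussian_div hA c hc)
    (Filter.Eventually.of_forall fun _ => (Real.exp_pos _).le)

theorem abs_intervalIntegral_gaussian_sub_le {r : ℝ} (hr : 1 ≤ r) :
    |(∫ θ in (-Real.pi)..Real.pi, Real.exp (-(saddleVariance r * θ ^ 2 / 2))) -
        √(2 * Real.pi / saddleVariance r)| ≤
      4 * (1 / Real.exp r) * √(128 * Real.pi / saddleVariance r) := by
  have hA := saddleVariance_pos (by linarith : 0 < r)
  set A := saddleVariance r with hAd
  have hi2 := integrable_gaussian_div hA 2 (by norm_num)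
  have hi := integrable_gaussian_div hA 128 (by norm_num)
  rw [intervalIntegral.integral_of_le (by linarith [Real.pi_pos]), ← integral_gaussian_div,
    ← integral_gaussian_div, ← integral_add_compl (measurableSet_Ioc (a := -Real.pi)
      (b := Real.pi)) hi2, sub_add_cancel_left, abs_neg,
    abs_of_nonneg (integral_nonneg fun _ => (Real.exp_pos _).le)]
  calc _ ≤ ∫ θ in (Set.Ioc (-Real.pi) Real.pi)ᶜ,
        4 * (1 / Real.exp r) * Real.exp (-(A * θ ^ 2 / 128)) := by
        refine setIntegral_mono_on hi2.integrableOn (hi.const_mul _).integrableOn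
          measurableSet_Ioc.compl fun θ hθ => ?_
        refine exp_neg_saddleVariance_mul_sq_le hr ?_
        have h1 : 1 / r ≤ 1 := by rw [div_le_one (by linarith)]; exact hr
        have hpi := Real.pi_gt_three
        by_contra! h
        have := abs_lt.1 h
        exact hθ ⟨by linarith, by linarith⟩
    _ ≤ ∫ θ, 4 * (1 / Real.exp r) * Real.exp (-(A * θ ^ 2 / 128)) :=
        setIntegral_le_integral (hi.const_mul _)
          (Filter.Eventually.of_forall fun _ => by positivity)
    _ = _ := integral_const_mul _ _

theorem norm_integral_cexp_phase_sub_le {T : Finset ℕ} {r Q : ℝ} (hr : 1 ≤ r) (hQ : 1 ≤ Q)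
    (hD : weightMoment T r 1 ≤ 3 * r * Q) (hE : weightMoment T r 2 ≤ 3 * r ^ 2 * Q)
    (hEA : weightMoment T r 2 ≤ saddleVariance r / 64)
    (htail : ∀ θ, 1 / r ≤ |θ| → |θ| ≤ Real.pi → (phase T r θ).re ≤ -(2 * r)) :
    ‖(∫ θ in (-Real.pi)..Real.pi, Complex.exp (phase T r θ)) -
        (√(2 * Real.pi / saddleVariance r) : ℝ)‖ ≤
      (2000 * 128 ^ 3 + 8) * (Q ^ 2 / Real.exp r) * √(128 * Real.pi / saddleVariance r)
        + 2 * Real.pi * Real.exp (-(2 * r)) := by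
  have hA := saddleVariance_pos (by linarith : 0 < r)
  have hgauss := abs_intervalIntegral_gaussian_sub_le hr
  have hpi := Real.pi_pos
  have hW : 1 / Real.exp r ≤ Q ^ 2 / Real.exp r := by
    gcongr
    nlinarith
  have hsymm : ∀ θ, 1 / r ≤ |θ| → |θ| ≤ Real.pi →
      ‖(Complex.exp (phase T r θ) + Complex.exp (phase T r (-θ))) / 2‖ ≤
        Real.exp (-(2 * r)) := by
    intro θ h1 h2
    rw [norm_div, Complex.norm_ofNat, div_le_iff₀ (by norm_num)]
    refine (norm_add_le _ _).trans ?_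
    rw [Complex.norm_exp, Complex.norm_exp]
    have h3 := Real.exp_le_exp.2 (htail θ h1 h2)
    have h4 := Real.exp_le_exp.2 (htail (-θ) (by rwa [abs_neg]) (by rwa [abs_neg]))
    linarith
  set W := Q ^ 2 / Real.exp r
  have hW0 : 0 ≤ W := by positivity
  have hpt : ∀ θ ∈ Set.Ioc (-Real.pi) Real.pi,
      ‖(Complex.exp (phase T r θ) + Complex.exp (phase T r (-θ))) / 2 -
        Real.exp (-(saddleVariance r * θ ^ 2 / 2))‖ ≤
      (2000 * 128 ^ 3 + 4) * W * Real.exp (-(saddleVariance r * θ ^ 2 / 128))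
        + Real.exp (-(2 * r)) := by
    intro θ hθ
    have hθ' : |θ| ≤ Real.pi := abs_le.2 ⟨hθ.1.le, hθ.2⟩
    have hY := Real.exp_pos (-(saddleVariance r * θ ^ 2 / 128))
    have hWY := mul_nonneg hW0 hY.le
    rcases le_total |θ| (1 / r) with h | h
    · have := norm_symm_cexp_phase_sub_le hr hQ hD hE hEA h
      have := Real.exp_pos (-(2 * r))
      linarith
    · have h1 := hsymm θ h hθ'
      have h2 := exp_neg_saddleVariance_mul_sq_le hr h
      have h3 := mul_le_mul_of_nonneg_right hW hY.le
      refine (norm_sub_le _ _).trans ?_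
      rw [Complex.norm_real, Real.norm_of_nonneg (Real.exp_pos _).le]
      linarith
  have hc : Continuous fun θ => Complex.exp (phase T r θ) :=
    Complex.continuous_exp.comp (continuous_phase T r)
  have hcs : Continuous fun θ =>
      (Complex.exp (phase T r θ) + Complex.exp (phase T r (-θ))) / 2 :=
    (hc.add (hc.comp continuous_neg)).div_const _
  have hcg : Continuous fun θ : ℝ => ((Real.exp (-(saddleVariance r * θ ^ 2 / 2)) : ℝ) : ℂ) := by
    fun_prop
  have hcY : Continuous fun θ : ℝ =>
      (2000 * 128 ^ 3 + 4) * W * Real.exp (-(saddleVariance r * θ ^ 2 / 128)) := by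
    fun_prop
  have hI := intervalIntegral.norm_integral_le_of_norm_le (μ := volume)
    (by linarith : -Real.pi ≤ Real.pi)
    (Filter.Eventually.of_forall hpt)
    ((hcY.add continuous_const).intervalIntegrable _ _)
  rw [intervalIntegral.integral_sub (hcs.intervalIntegrable _ _) (hcg.intervalIntegrable _ _),
    integral_symm_cexp_phase, intervalIntegral.integral_ofReal,
    intervalIntegral.integral_add (hcY.intervalIntegrable _ _)
      (continuous_const.intervalIntegrable _ _), intervalIntegral.integral_const_mul,
    intervalIntegral.integral_const, smul_eq_mul] at hI
  have hYle := mul_le_mul_of_nonneg_left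
    (intervalIntegral_gaussian_le hA (by norm_num : (0 : ℝ) < 128))
    (by positivity : 0 ≤ (2000 * 128 ^ 3 + 4) * W)
  rw [← Real.norm_eq_abs, ← Complex.norm_real, Complex.ofReal_sub] at hgauss
  have hWs := mul_le_mul_of_nonneg_right hW (Real.sqrt_nonneg (128 * Real.pi / saddleVariance r))
  refine (norm_sub_le_norm_sub_add_norm_sub _ _ _).trans ((add_le_add hI hgauss).trans ?_)
  linarith

/-- The effect of the normalising factor on each part of the integral estimate. That factor is `O(e
^ r)`, so a tail of size `e ^ (-2 r)` contributes only `O(e ^ (-r))`. -/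
theorem sqrt_variance_bounds {r : ℝ} (hr : 1 ≤ r) :
    √(saddleVariance r / (2 * Real.pi)) * √(128 * Real.pi / saddleVariance r) = 8 ∧
    √(saddleVariance r / (2 * Real.pi)) * √(2 * Real.pi / saddleVariance r) = 1 ∧
    √(saddleVariance r / (2 * Real.pi)) * (2 * Real.pi * Real.exp (-(2 * r))) ≤
      4 * (1 / Real.exp r) := by
  have hA := saddleVariance_pos (by linarith : 0 < r)
  have hpi := Real.pi_pos
  have hpi4 := Real.pi_lt_four
  refine ⟨?_, ?_, ?_⟩
  · rw [← Real.sqrt_mul (by positivity)]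
    rw [show saddleVariance r / (2 * Real.pi) * (128 * Real.pi / saddleVariance r) = 8 ^ 2 by
      field_simp; norm_num]
    exact Real.sqrt_sq (by norm_num)
  · rw [← Real.sqrt_mul (by positivity)]
    rw [show saddleVariance r / (2 * Real.pi) * (2 * Real.pi / saddleVariance r) = 1 by
      field_simp]
    exact Real.sqrt_one
  · have hq := Real.quadratic_le_exp_of_nonneg (by linarith : 0 ≤ r)
    have hAle : saddleVariance r ≤ 2 * Real.exp r ^ 2 := by
      have : r * (r + 1) ≤ 2 * Real.exp r := by nlinarith
      have := mul_le_mul_of_nonneg_right this (Real.exp_pos r).le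
      unfold saddleVariance
      linarith
    have h1 : √(saddleVariance r / (2 * Real.pi)) * (2 * Real.pi) ≤ 4 * Real.exp r := by
      rw [← Real.sqrt_sq (by positivity : 0 ≤ 2 * Real.pi), ← Real.sqrt_mul (by positivity)]
      rw [Real.sqrt_sq (by positivity : 0 ≤ 2 * Real.pi)]
      refine Real.sqrt_le_iff.2 ⟨by positivity, ?_⟩
      rw [show saddleVariance r / (2 * Real.pi) * (2 * Real.pi) ^ 2 =
        saddleVariance r * (2 * Real.pi) by field_simp]
      nlinarith [mul_le_mul hAle (by linarith : 2 * Real.pi ≤ 8) (by positivity) (by positivity)]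
    have e : Real.exp (-(2 * r)) = 1 / Real.exp r * (1 / Real.exp r) := by
      rw [one_div, ← Real.exp_neg, ← Real.exp_add]; ring_nf
    rw [e, ← mul_assoc]
    calc _ ≤ 4 * Real.exp r * (1 / Real.exp r * (1 / Real.exp r)) := by gcongr
      _ = _ := by field_simp

/-! ### The threshold and the size of the excluded moments -/

theorem mul_one_sub_log_mono {x y : ℝ} (hx : 0 < x) (hxy : x ≤ y) (hy : y ≤ 1) :
    x * (1 - Real.log x) ≤ y * (1 - Real.log y) := by
  have hy0 : 0 < y := by linarith
  have h1 := Real.log_le_sub_one_of_pos (div_pos hy0 hx)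
  rw [Real.log_div hy0.ne' hx.ne', le_sub_iff_add_le, le_div_iff₀ hx] at h1
  nlinarith [Real.log_nonpos hy0.le hy]

theorem exists_mul_one_sub_log_eq {y : ℝ} (hy : 0 ≤ y) (h : 1 / 2 ≤ y * (1 - Real.log y)) :
    ∃ x, 0 < x ∧ x ≤ y ∧ x * (1 - Real.log x) = 1 / 2 := by
  have hc : ContinuousOn (fun x : ℝ => x * (1 - Real.log x)) (Set.Icc 0 y) := by
    have : (fun x : ℝ => x * (1 - Real.log x)) = fun x => x - x * Real.log x := by ext; ring
    rw [this]
    exact (continuous_id.sub Real.continuous_mul_log).continuousOn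
  obtain ⟨x, hx, hfx⟩ := intermediate_value_Icc hy hc (show (1 / 2 : ℝ) ∈ _ from ⟨by simp, h⟩)
  refine ⟨x, lt_of_le_of_ne hx.1 ?_, hx.2, hfx⟩
  rintro rfl
  norm_num at hfx

/-- By the intermediate value theorem from `0`, any `y ≥ 0` where the function is at least `1/2` has
a root in `(0, y]`, hence `η ≤ y`. The choice `y = 1` gives the first claim, `y = δ` the second. -/
theorem le_one_and_mul_one_sub_log_le {η δ : ℝ}
    (hη : IsLeast {η : ℝ | 0 < η ∧ η * (1 - Real.log η) = 1 / 2} η) (hδ : 0 < δ) (hδη : δ < η) :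
    δ ≤ 1 ∧ δ * (1 - Real.log δ) ≤ 1 / 2 := by
  have key : ∀ y, 0 ≤ y → 1 / 2 ≤ y * (1 - Real.log y) → η ≤ y := by
    intro y hy h
    obtain ⟨x, hx, hxy, hfx⟩ := exists_mul_one_sub_log_eq hy h
    exact (hη.2 ⟨hx, hfx⟩).trans hxy
  constructor
  · have := key 1 zero_le_one (by norm_num)
    linarith
  · by_contra! h
    exact absurd (key δ hδ.le h.le) (not_le.2 hδη)

/-- With `x = m / r`, `(e r / m) ^ m = exp (r x (1 - log x))`, and `x (1 - log x)` increases on `(0,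
1]`. This is the origin of the equation for `η₁`. -/
theorem pow_le_exp_half {δ r : ℝ} {m : ℕ} (hδ1 : δ ≤ 1)
    (hδ : δ * (1 - Real.log δ) ≤ 1 / 2) (hr : 0 < r) (hm : 1 ≤ m) (hmr : (m : ℝ) ≤ δ * r) :
    (Real.exp 1 * r / m) ^ (m - 1) ≤ Real.exp (r / 2) := by
  have hm0 : (0 : ℝ) < m := by exact_mod_cast hm
  have hx : 0 < m / r := by positivity
  have hxδ : m / r ≤ δ := by rwa [div_le_iff₀ hr]
  have h1 := (mul_one_sub_log_mono hx hxδ hδ1).trans hδ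
  have hbase : Real.exp 1 * r / m = Real.exp (1 - Real.log (m / r)) := by
    rw [Real.exp_sub, Real.exp_log hx]
    field_simp
  have hge : 0 ≤ 1 - Real.log (m / r) := by
    linarith [Real.log_nonpos hx.le (hxδ.trans hδ1)]
  rw [hbase, ← Real.exp_nat_mul]
  refine Real.exp_le_exp.2 ?_
  calc ((m - 1 : ℕ) : ℝ) * (1 - Real.log (m / r)) ≤ m * (1 - Real.log (m / r)) := by
        gcongr
        exact Nat.sub_le _ _
    _ = r * (m / r * (1 - Real.log (m / r))) := by field_simp
    _ ≤ r * (1 / 2) := by gcongr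
    _ = r / 2 := by ring

/-- Rankin's trick: for `j ≤ m - 1`, `r ^ j ≤ (r / m) ^ (m - 1) m ^ j`, and the sum of `m ^ j / j!`
is at most `e ^ m`. The remaining factor `e` is rounded up to 3. -/
theorem weightMoment_one_le {T : Finset ℕ} {r : ℝ} {m : ℕ} (hT : T ⊆ Finset.Icc 1 m)
    (hm : 1 ≤ m) (hmr : (m : ℝ) ≤ r) :
    weightMoment T r 1 ≤ 3 * r * (Real.exp 1 * r / m) ^ (m - 1) := by
  have hm0 : (0 : ℝ) < m := by exact_mod_cast hm
  have hr : 0 < r := by linarith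
  have hrm : 1 ≤ r / m := by rwa [one_le_div hm0]
  calc weightMoment T r 1 ≤ weightMoment (Finset.Icc 1 m) r 1 :=
        Finset.sum_le_sum_of_subset_of_nonneg hT fun k _ _ => by positivity
    _ = ∑ j ∈ Finset.range m, r * (r ^ j / j.factorial) := by
        have hIcc : Finset.Icc 1 m = Finset.Ico (0 + 1) (m + 1) := by
          ext; simp only [Finset.mem_Icc, Finset.mem_Ico]; omega
        rw [weightMoment, hIcc, ← Finset.sum_Ico_add', Finset.range_eq_Ico]
        refine Finset.sum_congr rfl fun j _ => ?_
        have : (j.factorial : ℝ) ≠ 0 := by positivity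
        rw [Nat.factorial_succ]
        push_cast
        field_simp
        ring
    _ ≤ ∑ j ∈ Finset.range m, r * ((r / m) ^ (m - 1) * ((m : ℝ) ^ j / j.factorial)) := by
        refine Finset.sum_le_sum fun j hj => ?_
        rw [Finset.mem_range] at hj
        have h1 : r ^ j ≤ (r / m) ^ (m - 1) * (m : ℝ) ^ j := by
          calc r ^ j = (r / m) ^ j * (m : ℝ) ^ j := by rw [← mul_pow]; congr 1; field_simp
            _ ≤ _ := mul_le_mul_of_nonneg_right (pow_le_pow_right₀ hrm (by omega)) (by positivity)
        rw [← mul_div_assoc ((r / m) ^ (m - 1))]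
        exact mul_le_mul_of_nonneg_left (by gcongr) hr.le
    _ = r * (r / m) ^ (m - 1) * ∑ j ∈ Finset.range m, (m : ℝ) ^ j / j.factorial := by
        rw [Finset.mul_sum]
        exact Finset.sum_congr rfl fun j _ => by ring
    _ ≤ r * (r / m) ^ (m - 1) * Real.exp m := by
        gcongr
        exact Real.sum_le_exp_of_nonneg hm0.le m
    _ = Real.exp 1 * r * (Real.exp 1 * r / m) ^ (m - 1) := by
        have : Real.exp m = Real.exp 1 ^ (m - 1) * Real.exp 1 := by
          rw [← pow_succ, Nat.sub_add_cancel hm, ← Real.exp_nat_mul, mul_one]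
        rw [this, mul_div_assoc, mul_pow]
        ring
    _ ≤ 3 * r * (Real.exp 1 * r / m) ^ (m - 1) := by
        gcongr
        linarith [Real.exp_one_lt_d9]

theorem weightMoment_two_le {T : Finset ℕ} {r : ℝ} {m : ℕ} (hT : T ⊆ Finset.Icc 1 m)
    (hr : 0 ≤ r) (hmr : (m : ℝ) ≤ r) :
    weightMoment T r 2 ≤ r * weightMoment T r 1 := by
  rw [weightMoment, weightMoment, Finset.mul_sum]
  refine Finset.sum_le_sum fun k hk => ?_
  have hk' : (k : ℝ) ≤ r := le_trans (by exact_mod_cast (Finset.mem_Icc.1 (hT hk)).2) hmr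
  rw [← mul_assoc, pow_one, sq]
  gcongr

/-! ### The ratio to the main term, for large and for bounded radius -/

theorem alphaFun_coe (T : Finset ℕ) (r : ℝ) :
    alphaFun (T : Set ℕ) r = ∑ k ∈ T, r ^ k / (k.factorial : ℝ) :=
  Finset.tsum_subtype' T fun k => r ^ k / (k.factorial : ℝ)

theorem blockEGF_ofReal (T : Finset ℕ) (r : ℝ) :
    blockEGF T r = ((Real.exp r - 1 - alphaFun T r : ℝ) : ℂ) := by
  rw [alphaFun_coe, blockEGF]
  push_cast
  rfl

theorem alphaFun_le {T : Finset ℕ} (hT : 0 ∉ T) {r : ℝ} (hr : 0 ≤ r) :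
    alphaFun T r ≤ Real.exp r - 1 := by
  have := sum_le_hasSum (insert 0 T) (fun k _ => by positivity) (hasSum_pow_div_factorial r)
  rw [Finset.sum_insert hT] at this
  rw [alphaFun_coe]
  simp at this
  linarith

theorem mainTerm_pos (n : ℕ) (S : Set ℕ) {r : ℝ} (hr : 0 < r) : 0 < mainTerm n S r := by
  unfold mainTerm
  have := Real.pi_pos
  positivity

theorem partitionCount_div_mainTerm {n : ℕ} {T : Finset ℕ} (hT : 0 ∉ T) {r : ℝ} (hr : 0 < r)
    (hn : r * Real.exp r = n) :
    ((partitionCount n (T : Set ℕ) / mainTerm n T r : ℝ) : ℂ) =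
      (√(saddleVariance r / (2 * Real.pi)) : ℝ) *
        ∫ θ in (-Real.pi)..Real.pi, Complex.exp (phase T r θ) := by
  have h := partitionCount_eq_integral n hT hr
  have hA := saddleVariance_pos hr
  have hpi := Real.pi_pos
  have he : ∀ θ : ℝ, Complex.exp (blockEGF T (r * Complex.exp (θ * Complex.I)) - n * θ * Complex.I)
      = Complex.exp (blockEGF T r) * Complex.exp (phase T r θ) := by
    intro θ
    rw [← Complex.exp_add, phase, hn]
    congr 1
    push_cast
    ring
  simp only [he, intervalIntegral.integral_const_mul] at h
  set J := ∫ θ in (-Real.pi)..Real.pi, Complex.exp (phase T r θ)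
  have hs : √(saddleVariance r / (2 * Real.pi)) =
      √(2 * Real.pi * r * (r + 1) * Real.exp r) / (2 * Real.pi) := by
    rw [eq_div_iff (by positivity)]
    nth_rw 2 [← Real.sqrt_sq (by positivity : 0 ≤ 2 * Real.pi)]
    rw [← Real.sqrt_mul (by positivity)]
    congr 1
    unfold saddleVariance
    field_simp
  rw [blockEGF_ofReal, ← Complex.ofReal_exp] at h
  rw [hs, mainTerm]
  have hsq : (0 : ℝ) < √(2 * Real.pi * r * (r + 1) * Real.exp r) := by positivity
  set s := √(2 * Real.pi * r * (r + 1) * Real.exp r)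
  set X := Real.exp (Real.exp r - 1 - alphaFun T r) with hX
  have hX0 : 0 < X := Real.exp_pos _
  have hXc : (X : ℂ) ≠ 0 := by exact_mod_cast hX0.ne'
  have hr' : (r : ℂ) ≠ 0 := by exact_mod_cast hr.ne'
  have hsc : (s : ℂ) ≠ 0 := by exact_mod_cast hsq.ne'
  have hn' : (n.factorial : ℂ) ≠ 0 := by exact_mod_cast n.factorial_ne_zero
  have hpi' : (Real.pi : ℂ) ≠ 0 := by exact_mod_cast hpi.ne'
  push_cast
  field_simp at h ⊢
  linear_combination h

theorem abs_partitionCount_div_mainTerm_sub_one_le {n m : ℕ} {T : Finset ℕ} {δ r : ℝ}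
    (hδ1 : δ ≤ 1) (hδ : δ * (1 - Real.log δ) ≤ 1 / 2) (hr : 3840 ≤ r)
    (hn : r * Real.exp r = n) (hT : T ⊆ Finset.Icc 1 m) (hm : 1 ≤ m) (hmr : (m : ℝ) ≤ δ * r) :
    |partitionCount n (T : Set ℕ) / mainTerm n T r - 1| ≤
      (8 * (2000 * 128 ^ 3 + 8) + 4) *
        ((Real.exp 1 * r / m) ^ (2 * m - 2) / Real.exp r) := by
  have hr0 : 0 < r := by linarith
  have hr1 : 1 ≤ r := by linarith
  have hm0 : (0 : ℝ) < m := by exact_mod_cast hm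
  have hT0 : 0 ∉ T := fun h => by simpa using hT h
  have hmr' : (m : ℝ) ≤ r := hmr.trans (mul_le_of_le_one_left hr0.le hδ1)
  have hQhalf := pow_le_exp_half hδ1 hδ hr0 hm hmr
  have hD := weightMoment_one_le hT hm hmr'
  have hE0 := weightMoment_two_le hT hr0.le hmr'
  have hQ1 : 1 ≤ (Real.exp 1 * r / m) ^ (m - 1) := by
    refine one_le_pow₀ ?_
    rw [one_le_div hm0]
    nlinarith [Real.add_one_le_exp (1 : ℝ)]
  have hQ2 : (Real.exp 1 * r / m) ^ (2 * m - 2) = ((Real.exp 1 * r / m) ^ (m - 1)) ^ 2 := by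
    rw [← pow_mul]
    congr 1
    omega
  rw [hQ2]
  set Q := (Real.exp 1 * r / m) ^ (m - 1)
  have hE : weightMoment T r 2 ≤ 3 * r ^ 2 * Q := by
    have := mul_le_mul_of_nonneg_left hD hr0.le
    linarith
  -- The cubic term of the series is `r ^ 3 / 48`, and `3840 = 48 * 80`.
  have hy : 80 * r ^ 2 ≤ Real.exp (r / 2) := by
    have := Real.pow_div_factorial_le_exp (r / 2) (by positivity) 3
    norm_num [Nat.factorial] at this
    nlinarith [mul_le_mul_of_nonneg_right hr (sq_nonneg r)]
  have hyy : Real.exp r = Real.exp (r / 2) ^ 2 := by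
    rw [← Real.exp_nat_mul]; congr 1; push_cast; ring
  set y := Real.exp (r / 2) with hydef
  have hy0 : 0 < y := Real.exp_pos _
  have hEA : weightMoment T r 2 ≤ saddleVariance r / 64 := by
    have h1 := sq_mul_exp_le_saddleVariance hr0.le
    rw [hyy] at h1
    have h2 : 3 * r ^ 2 * Q ≤ 3 * r ^ 2 * y := by gcongr
    have h3 : (192 : ℝ) ≤ y := by nlinarith
    have h4 : r ^ 2 * (192 * y) ≤ r ^ 2 * y ^ 2 := by
      rw [sq y]; gcongr
    linarith
  have htail : ∀ θ, 1 / r ≤ |θ| → |θ| ≤ Real.pi → (phase T r θ).re ≤ -(2 * r) := by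
    intro θ h1 h2
    refine (re_phase_le_of_le_abs hT0 hr1 h1 h2).trans ?_
    -- The excluded sizes cost at most `6 r y`, so `-2 r y ≤ -2 r` is left.
    have h3 : 8 * r * y ≤ Real.exp r / (10 * r) := by
      rw [le_div_iff₀ (by positivity), hyy]
      nlinarith
    have h4 : 3 * r * Q ≤ 3 * r * y := by gcongr
    have h5 : 2 * r * 1 ≤ 2 * r * y := by
      gcongr
      nlinarith
    linarith
  have hJ := norm_integral_cexp_phase_sub_le hr1 hQ1 hD hE hEA htail
  obtain ⟨s1, s2, s3⟩ := sqrt_variance_bounds hr1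
  have hW : 1 / Real.exp r ≤ Q ^ 2 / Real.exp r := by
    gcongr
    nlinarith
  have hsn := Real.sqrt_nonneg (saddleVariance r / (2 * Real.pi))
  rw [← Real.norm_eq_abs, ← Complex.norm_real, Complex.ofReal_sub,
    partitionCount_div_mainTerm hT0 hr0 hn, Complex.ofReal_one, ← Complex.ofReal_one, ← s2,
    Complex.ofReal_mul, ← mul_sub, norm_mul, Complex.norm_real, Real.norm_of_nonneg hsn]
  refine (mul_le_mul_of_nonneg_left hJ hsn).trans ?_
  rw [mul_add, mul_left_comm, s1]
  linarith

theorem partitionCount_le (n : ℕ) (S : Set ℕ) :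
    partitionCount n S ≤ Nat.card (Finpartition (Finset.univ : Finset (Fin n))) :=
  Finite.card_subtype_le _

/-- Since `n ≤ R e ^ R`, finitely many Bell numbers bound the counts for every `T`. The main term
stays away from `0` because `α(r) ≤ e ^ r - 1` makes its exponential at least 1. -/
theorem exists_abs_partitionCount_div_mainTerm_sub_one_le (R : ℝ) (hR : 1 ≤ R) :
    ∃ M : ℝ, 0 < M ∧ ∀ (n : ℕ) (r : ℝ) (T : Finset ℕ), 0 ∉ T → 0 < r → r ≤ R →
      r * Real.exp r = n → |partitionCount n (T : Set ℕ) / mainTerm n T r - 1| ≤ M := by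
  set N := ⌊R * Real.exp R⌋₊
  set K : ℕ := ∑ k ∈ Finset.range (N + 1), Nat.card (Finpartition (Finset.univ : Finset (Fin k)))
  have hpi := Real.pi_pos
  refine ⟨K * (R ^ N * √(2 * Real.pi * R * (R + 1) * Real.exp R)) + 1, by positivity, ?_⟩
  intro n r T hT hr hrR hn
  have hnN : n ≤ N := by
    refine Nat.le_floor ?_
    rw [← hn]
    gcongr
  have hK : (partitionCount n (T : Set ℕ) : ℝ) ≤ K := by
    have h1 : Nat.card (Finpartition (Finset.univ : Finset (Fin n))) ≤ K :=
      Finset.single_le_sum (f := fun k => Nat.card (Finpartition (Finset.univ : Finset (Fin k))))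
        (fun _ _ => Nat.zero_le _) (Finset.mem_range.2 (by omega))
    exact_mod_cast (partitionCount_le n _).trans h1
  have hmain : 1 / mainTerm n T r ≤ R ^ N * √(2 * Real.pi * R * (R + 1) * Real.exp R) := by
    rw [mainTerm, one_div_div]
    have hden : 1 ≤ (n.factorial : ℝ) * Real.exp (Real.exp r - 1 - alphaFun T r) := by
      refine one_le_mul_of_one_le_of_one_le (by exact_mod_cast n.factorial_pos) ?_
      exact Real.one_le_exp (by linarith [alphaFun_le hT hr.le])
    refine (div_le_self (by positivity) hden).trans ?_
    have : r ^ n ≤ R ^ N := (pow_le_pow_left₀ hr.le hrR n).trans (pow_le_pow_right₀ hR hnN)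
    gcongr
  have hpos := mainTerm_pos n T hr
  have h2 : partitionCount n (T : Set ℕ) / mainTerm n T r ≤
      K * (R ^ N * √(2 * Real.pi * R * (R + 1) * Real.exp R)) := by
    rw [div_eq_mul_one_div]
    gcongr
  have h3 : 0 ≤ partitionCount n (T : Set ℕ) / mainTerm n T r := by positivity
  rw [abs_le]
  constructor <;> linarith

theorem corollary1 (η₁ δ₁ : ℝ)
    (hη₁ : IsLeast {η : ℝ | 0 < η ∧ η * (1 - Real.log η) = 1 / 2} η₁)
    (hδ₁ : 0 < δ₁) (hδη : δ₁ < η₁) :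
    ∃ C : ℝ, 0 < C ∧
      ∀ (n : ℕ) (r : ℝ), r * Real.exp r = (n : ℝ) →
        ∀ (S : Set ℕ) (m : ℕ), 0 ∉ S → IsGreatest S m → 1 ≤ m → (m : ℝ) ≤ δ₁ * r →
          ∃ ε : ℝ,
            |ε| ≤ C * ((Real.exp 1 * r / (m : ℝ)) ^ (2 * m - 2) / Real.exp r) ∧
            (partitionCount n S : ℝ) = mainTerm n S r * (1 + ε) := by
  obtain ⟨hδ1, hδ⟩ := le_one_and_mul_one_sub_log_le hη₁ hδ₁ hδη
  obtain ⟨M, hM, hsmall⟩ := exists_abs_partitionCount_div_mainTerm_sub_one_le 3840 (by norm_num)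
  refine ⟨max (8 * (2000 * 128 ^ 3 + 8) + 4) (M * Real.exp 3840),
    lt_max_of_lt_left (by norm_num), ?_⟩
  intro n r hn S m hS0 hSm hm hmr
  have hfin : S.Finite := (Set.finite_Iic m).subset fun k hk => hSm.2 hk
  obtain ⟨T, rfl⟩ := hfin.exists_finset_coe
  have hT0 : 0 ∉ T := by simpa using hS0
  have hm0 : (0 : ℝ) < m := by exact_mod_cast hm
  have hr : 0 < r := pos_of_mul_pos_right (hm0.trans_le hmr) hδ₁.le
  have hTm : T ⊆ Finset.Icc 1 m := fun k hk => Finset.mem_Icc.2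
    ⟨Nat.one_le_iff_ne_zero.2 fun h => hT0 (h ▸ hk), hSm.2 (Finset.mem_coe.2 hk)⟩
  have hpos := mainTerm_pos n T hr
  refine ⟨partitionCount n (T : Set ℕ) / mainTerm n T r - 1, ?_, by field_simp; ring⟩
  rcases le_total 3840 r with h | h
  · refine (abs_partitionCount_div_mainTerm_sub_one_le hδ1 hδ h hn hTm hm hmr).trans ?_
    gcongr
    exact le_max_left _ _
  · have hmr' : (m : ℝ) ≤ r := hmr.trans (mul_le_of_le_one_left hr.le hδ1)
    -- For `r ≤ 3840` the claimed error is therefore at least `C / e ^ 3840`, which the choice of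
    -- `C` makes at least `M`.
    have hQ : 1 ≤ (Real.exp 1 * r / m) ^ (2 * m - 2) := by
      refine one_le_pow₀ ?_
      rw [one_le_div hm0]
      nlinarith [Real.add_one_le_exp (1 : ℝ)]
    calc _ ≤ M := hsmall n r T hT0 hr h hn
      _ = M * Real.exp 3840 * (1 / Real.exp 3840) := by field_simp
      _ ≤ _ := by
        gcongr
        exact le_max_right _ _
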